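/- Assume $\mathrm{CH}$. Let $\langle C_\alpha : \alpha<\omega_2\rangle$ be a $\square_{\omega_1}$-sequence in the following sense: for every $\alpha<\omega_2$, $C_\alpha$ is a closed unbounded subset of $\alpha$ (unbounded: for every $\gamma<\alpha$ there is $\delta\in C_\alpha$ with $\gamma\le\delta$); $\mathrm{otp}(C_\alpha)\le\omega_1$, and $\mathrm{otp}(C_\alpha)<\omega_1$ if $\mathrm{cf}(\alpha)=\omega$; if $\beta<\omega_2$ is a limit ordinal and $\alpha\in C_\beta$ then $\mathrm{cf}(\alpha)\le\omega$; and if $\alpha<\beta<\omega_2$ and $\alpha$ is a limit point of $C_\beta$ then $C_\beta\cap\alpha=C_\alpha$. Let $\rho$ be defined recursively by $\rho(\alpha,\alpha)=0$ and, for $\alpha<\beta<\omega_2$, $$\rho(\alpha,\beta)=\max\{\mathrm{otp}(C_\beta\cap\alpha),\ \rho(\alpha,\min(C_\beta\setminus\alpha)),\ \rho(\xi,\alpha):\xi\in C_\beta\cap[\Lambda(\alpha,\beta),\alpha)\},$$ where $\Lambda(\alpha,\beta)$ is the maximal limit point of $C_\beta\cap(\alpha+1)$, or $0$ if there is none. Let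 $Q$ be the poset of all finite functions $p$ with $\mathrm{dom}(p)\subset\omega_2$ and values in $[\omega_1]^{<\omega}$ such that: for all $\alpha\in\mathrm{dom}(p)$ and $\nu<\omega_1$, $p(\alpha)\cap[\nu,\nu+\omega)$ has at most one element; for all $\alpha,\beta\in\mathrm{dom}(p)$, $p(\alpha)\cap p(\beta)$ is an initial segment of both $p(\alpha)$ and $p(\beta)$; and for all $\alpha<\beta$ in $\mathrm{dom}(p)$, every element of $p(\alpha)\cap p(\beta)$ is at most $\rho(\alpha,\beta)$. Order $Q$ by $q\le p$ iff $\mathrm{dom}(p)\subset\mathrm{dom}(q)$ and $p(\alpha)\subset q(\alpha)$ for all $\alpha\in\mathrm{dom}(p)$. For an ordinal $\mu$ let $Q_\mu=\{p\in Q:\mathrm{dom}(p)\subset\mu\}$. Let $\theta>\aleph_2$ be a regular cardinal, let $H_\theta$ be the set of all sets whose transitive closure has size less than $\theta$, and let $\langle N_\xi:\xi<\omega_1\rangle$ be a continuous $\in$-chain of countable elementary submodels of $(H_\theta,\in)$ (that is, $N_\xi\in N_{\xi+1}$ for all $\xi<\omega_1$, and $N_\xi=\bigcup_{\eta<\xi}N_\eta$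 for limit $\xi<\omega_1$) such that $\rho\in N_\xi$ for some $\xi<\omega_1$, where $\rho$ is regarded as a function on the pairs $\alpha<\beta<\omega_2$. Let $\mu=\sup\big(\bigcup_{\xi<\omega_1}N_\xi\cap\omega_2\big)$. Then $Q_\mu$ is a complete suborder of $Q$: any two elements of $Q_\mu$ that are compatible in $Q$ are compatible in $Q_\mu$, and for every $q\in Q$ there is $p\in Q_\mu$ such that every $r\le p$ with $r\in Q_\mu$ is compatible with $q$ in $Q$. -/

import Mathlib

open Cardinal Ordinal

universe u

namespace Komjath

noncomputable section

/-! ### Square sequences and the function `ρ` -/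

/-- The order type of a (bounded) set of ordinals: the ordinal `o` such that `A` is order
isomorphic to the set of ordinals below `o`. -/
def otp (A : Set Ordinal.{u}) : Ordinal.{u} :=
  sInf {o | Nonempty (Set.Iio o ≃o A)}

theorem otp_spec (A : Set Ordinal.{u}) (hA : BddAbove A) : Nonempty (Set.Iio (otp A) ≃o A) := by
  have hs : Small.{u} A := by
    obtain ⟨b, hb⟩ := hA
    exact small_subset (s := Set.Iic b) (t := A) fun x hx => hb hx
  let e : Shrink.{u} A ≃ A := (equivShrink A).symm
  let r : Shrink.{u} A → Shrink.{u} A → Prop := fun x y => e x < e y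
  let i : r ≃r ((· < ·) : A → A → Prop) := ⟨e, Iff.rfl⟩
  have : IsWellOrder _ r := i.toRelEmbedding.isWellOrder
  exact csInf_mem (s := {o | Nonempty (Set.Iio o ≃o A)})
    ⟨Ordinal.type r, ⟨OrderIso.ofRelIsoLT ((Ordinal.enum r).trans i)⟩⟩

/-- `l` is a limit point of the set of ordinals `A`. -/
def IsLimPt (l : Ordinal.{u}) (A : Set Ordinal.{u}) : Prop :=
  l ≠ 0 ∧ ∀ γ < l, ∃ δ ∈ A, γ < δ ∧ δ < l

/-- A `□_{ω₁}`-sequence `⟨C_α : α < ω₂⟩` (values at `α ≥ ω₂` are irrelevant). -/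
structure IsSquareSeq (C : Ordinal.{u} → Set Ordinal.{u}) : Prop where
  subset : ∀ α < ω_ 2, C α ⊆ Set.Iio α
  unbounded : ∀ α < ω_ 2, ∀ γ < α, ∃ δ ∈ C α, γ ≤ δ
  closed : ∀ α < ω_ 2, ∀ l < α, IsLimPt l (C α) → l ∈ C α
  otp_le : ∀ α < ω_ 2, otp (C α) ≤ ω_ 1
  otp_lt : ∀ α < ω_ 2, α.cof = ℵ₀ → otp (C α) < ω_ 1
  cof_le : ∀ β < ω_ 2, Order.IsSuccLimit β → ∀ α ∈ C β, α.cof ≤ ℵ₀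
  coherent : ∀ β < ω_ 2, ∀ α < β, IsLimPt α (C β) → C β ∩ Set.Iio α = C α

/-- `Λ(α, β)`: the maximal limit point of `C_β ∩ (α + 1)`, and `0` if there is none. -/
def lastLimit (C : Ordinal.{u} → Set Ordinal.{u}) (α β : Ordinal.{u}) : Ordinal.{u} :=
  sSup {l | l ≤ α ∧ IsLimPt l (C β)}

/-- `min (C_β \ α)`. -/
def nextStep (C : Ordinal.{u} → Set Ordinal.{u}) (α β : Ordinal.{u}) : Ordinal.{u} :=
  sInf {γ | γ ∈ C β ∧ α ≤ γ}

open Classical in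
/-- The function `ρ` of the sequence `C`: `ρ(α, α) = 0` and, for `α < β`, `ρ(α, β)` is the maximum
of `otp (C_β ∩ α)`, `ρ(α, min (C_β \ α))` and the `ρ(ξ, α)` for `ξ ∈ C_β ∩ [Λ(α, β), α)`.
The test `nextStep C α β < β` always succeeds for a square sequence; see `rho_of_lt`. -/
def rho (C : Ordinal.{u} → Set Ordinal.{u}) (α β : Ordinal.{u}) : Ordinal.{u} :=
  if _h : α < β then
    max (otp (C β ∩ Set.Iio α))
      (max (if _h' : nextStep C α β < β then rho C α (nextStep C α β) else 0)
        (⨆ ξ : {ξ // ξ ∈ C β ∧ lastLimit C α β ≤ ξ ∧ ξ < α}, rho C ξ.1 α))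
  else 0
termination_by β

theorem rho_self (C : Ordinal.{u} → Set Ordinal.{u}) (α : Ordinal.{u}) : rho C α α = 0 := by
  rw [rho]; simp

theorem nextStep_lt {C : Ordinal.{u} → Set Ordinal.{u}} (hC : IsSquareSeq C)
    {α β : Ordinal.{u}} (h : α < β) (hβ : β < ω_ 2) : nextStep C α β < β := by
  obtain ⟨δ, hδ, hαδ⟩ := hC.unbounded β hβ α h
  have hm : nextStep C α β ∈ {γ | γ ∈ C β ∧ α ≤ γ} := csInf_mem ⟨δ, hδ, hαδ⟩
  exact hC.subset β hβ hm.1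

theorem rho_of_lt {C : Ordinal.{u} → Set Ordinal.{u}} (hC : IsSquareSeq C)
    {α β : Ordinal.{u}} (h : α < β) (hβ : β < ω_ 2) :
    rho C α β = max (otp (C β ∩ Set.Iio α))
      (max (rho C α (nextStep C α β))
        (⨆ ξ : {ξ // ξ ∈ C β ∧ lastLimit C α β ≤ ξ ∧ ξ < α}, rho C ξ.1 α)) := by
  rw [rho, dif_pos h, dif_pos (nextStep_lt hC h hβ)]

/-! ### The forcing `Q` -/

/-- The conditions of the forcing `Q`: finite functions `p` with `dom p ⊆ ω₂` and values in
`[ω₁]^{<ω}`. A finite function is given by its domain and a total function that is `∅` off the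
domain (so that every finite function is represented exactly once). -/
structure Cond (ρ : Ordinal.{u} → Ordinal.{u} → Ordinal.{u}) where
  dom : Finset Ordinal.{u}
  val : Ordinal.{u} → Finset Ordinal.{u}
  val_off : ∀ α, α ∉ dom → val α = ∅
  dom_lt : ∀ α ∈ dom, α < ω_ 2
  val_lt : ∀ α ∈ dom, ∀ x ∈ val α, x < ω_ 1
  level : ∀ α ∈ dom, ∀ ν < ω_ 1, ∀ x ∈ val α, ∀ y ∈ val α,
    x ∈ Set.Ico ν (ν + ω) → y ∈ Set.Ico ν (ν + ω) → x = y
  initial : ∀ α ∈ dom, ∀ β ∈ dom, ∀ x ∈ val α ∩ val β, ∀ y ∈ val α, y < x → y ∈ val β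
  delta : ∀ α ∈ dom, ∀ β ∈ dom, α < β → ∀ x ∈ val α ∩ val β, x ≤ ρ α β

/-- `q ≤ p` iff `dom p ⊆ dom q` and `p(α) ⊆ q(α)` for all `α ∈ dom p`. -/
instance (ρ : Ordinal.{u} → Ordinal.{u} → Ordinal.{u}) : Preorder (Cond ρ) where
  le q p := p.dom ⊆ q.dom ∧ ∀ α ∈ p.dom, p.val α ⊆ q.val α
  le_refl p := ⟨Finset.Subset.refl _, fun _ _ => Finset.Subset.refl _⟩
  le_trans r q p hrq hqp := ⟨hqp.1.trans hrq.1, fun α hα =>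
    (hqp.2 α hα).trans (hrq.2 α (hqp.1 hα))⟩

/-- `Q_A`: the conditions whose domain is contained in `A`. -/
def condOn (ρ : Ordinal.{u} → Ordinal.{u} → Ordinal.{u}) (A : Set Ordinal.{u}) : Set (Cond ρ) :=
  {p | ∀ α ∈ p.dom, α ∈ A}

/-- `S`, with the inherited order, is a complete suborder of `P`: elements of `S` that are
compatible in `P` are compatible in `S`, and every `q ∈ P` has a reduction `p ∈ S`, that is,
every extension of `p` in `S` is compatible with `q` in `P`. -/
structure IsCompleteSuborder {P : Type*} [Preorder P] (S : Set P) : Prop where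
  compatible : ∀ p ∈ S, ∀ q ∈ S, (∃ r, r ≤ p ∧ r ≤ q) → ∃ r ∈ S, r ≤ p ∧ r ≤ q
  reduction : ∀ q : P, ∃ p ∈ S, ∀ r ∈ S, r ≤ p → ∃ s, s ≤ r ∧ s ≤ q

/-! ### Elementary submodels of `H_θ` -/

/-- The relation symbols of the language of set theory. -/
inductive MemRel : ℕ → Type
  | mem : MemRel 2

/-- The language of set theory. -/
def setLang : FirstOrder.Language.{0, 0} := ⟨fun _ => Empty, MemRel⟩

/-- `H_θ`: the sets whose transitive closure has cardinality less than `θ`. -/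
def hered (θ : Cardinal.{u}) : Set ZFSet.{u} :=
  {x | ∃ t : ZFSet.{u}, t.IsTransitive ∧ x ⊆ t ∧ t.card < θ}

/-- The structure `(H_θ, ∈)`. -/
instance heredStructure (θ : Cardinal.{u}) : setLang.Structure (hered θ) where
  funMap f := f.elim
  RelMap {_} r := match r with
    | MemRel.mem => fun v => (v 0).1 ∈ (v 1).1

/-- `M ≺ H_θ`. -/
def IsElemSubmodel (θ : Cardinal.{u}) (M : ZFSet.{u}) : Prop :=
  ∃ S : setLang.ElementarySubstructure (hered θ),
    ∀ x : ZFSet.{u}, x ∈ M ↔ ∃ y ∈ S, y.1 = x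

/-- `⟨N_ξ : ξ < ω₁⟩` is a continuous `∈`-chain of countable elementary submodels of `H_θ`
(values at `ξ ≥ ω₁` are irrelevant). -/
structure IsElemChain (θ : Cardinal.{u}) (N : Ordinal.{u} → ZFSet.{u}) : Prop where
  elem : ∀ ξ < ω_ 1, IsElemSubmodel θ (N ξ)
  countable : ∀ ξ < ω_ 1, (N ξ).card ≤ ℵ₀
  mem_succ : ∀ ξ < ω_ 1, N ξ ∈ N (Order.succ ξ)
  continuous : ∀ ξ < ω_ 1, Order.IsSuccLimit ξ → ∀ x, x ∈ N ξ ↔ ∃ η < ξ, x ∈ N η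

/-- `sup (⋃_{ξ < ω₁} N_ξ ∩ ω₂)`. -/
def chainSup (N : Ordinal.{u} → ZFSet.{u}) : Ordinal.{u} :=
  sSup {α | α < ω_ 2 ∧ ∃ ξ < ω_ 1, α.toZFSet ∈ N ξ}

/-- A function `ρ` on pairs `α < β < ω₂`, as a set: the set of all `((α, β), ρ(α, β))`. -/
def funGraph (ρ : Ordinal.{u} → Ordinal.{u} → Ordinal.{u}) : ZFSet.{u} :=
  ZFSet.range fun i : {i : Set.Iio (ω_ 2 : Ordinal.{u}) × Set.Iio (ω_ 2 : Ordinal.{u}) //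
      i.1.1 < i.2.1} =>
    ZFSet.pair (ZFSet.pair i.1.1.1.toZFSet i.1.2.1.toZFSet) (ρ i.1.1.1 i.1.2.1).toZFSet

end

end Komjath

/-! Compatibility in `Q_μ` follows by restricting a common extension to `μ`. For a reduction of `q`,
let the `β_j` be the points of `dom q` at or above `μ`, and let `ν < ω₁` lie above all values of
`q`. The sections `{α < β : ρ(α,β) ≤ ν}` are countable (`countable_rho_le`), and `μ` has uncountable
cofinality, in the form of `IsElemChain.exists_gt_of_countable`. So some `γ < μ` from the chain lies
above `dom q ∩ μ` and above every `α < μ` with `ρ(α,β_j) ≤ ν` for some `j`.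

The values of `ρ` below `ν` on pairs from `γ × {β_j}`, together with the order of the `β_j` and the
values below `ν` between them, form a countable subset of a set of size at most `ℵ₁`. By CH there
are at most `ℵ₁` such patterns. By elementarity a model containing `ρ`, `γ` and `ν` has an
`ω₁`-enumeration of representatives for all of them. Every countable ordinal enters the chain, so a
tuple `β'_j` with the same pattern occurs between `γ` and `μ` (`exists_same_pattern`).

Moving `β_j` to `β'_j` turns `q` into `p` (`exists_reduction_of_copy`). Given `r ≤ p` in `Q_μ`,
extend `r` by placing `r(β'_j) ∩ ν` at `β_j`. Bounds by `ρ` below `γ` and among the `β_j` transfer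
through the pattern; for `γ ≤ α < μ` they hold because `ρ(α,β_j) ≥ ν`. -/

namespace Komjath

open FirstOrder Language

variable {θ : Cardinal.{u}} {α β : Type} {S : setLang.ElementarySubstructure (hered θ)}
  {ρ : Ordinal.{u} → Ordinal.{u} → Ordinal.{u}} {N : Ordinal.{u} → ZFSet.{u}}

/-! ### Countability of the sections of `ρ` -/

/-- If `γ < γ'` gave equal order types, an isomorphism of `A ∩ γ'` onto `A ∩ γ` would be a strictly
increasing self-map of a well-order sending `γ` below itself. -/
theorem otp_inter_Iio_injOn (A : Set Ordinal.{u}) :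
    Set.InjOn (fun γ => otp (A ∩ Set.Iio γ)) A := by
  have key : ∀ γ ∈ A, ∀ γ' ∈ A, γ < γ' → otp (A ∩ Set.Iio γ) ≠ otp (A ∩ Set.Iio γ') := by
    intro γ hγ γ' hγ' hlt h
    obtain ⟨e⟩ := otp_spec (A ∩ Set.Iio γ) ⟨γ, fun x hx => hx.2.le⟩
    obtain ⟨e'⟩ := otp_spec (A ∩ Set.Iio γ') ⟨γ', fun x hx => hx.2.le⟩
    rw [h] at e
    let g : (A ∩ Set.Iio γ' : Set Ordinal.{u}) ≃o (A ∩ Set.Iio γ : Set Ordinal.{u}) :=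
      e'.symm.trans e
    let f : (A ∩ Set.Iio γ' : Set Ordinal.{u}) → (A ∩ Set.Iio γ' : Set Ordinal.{u}) :=
      fun x => ⟨(g x).1, (g x).2.1, (g x).2.2.trans hlt⟩
    have hf : StrictMono f := fun x y hxy => g.strictMono hxy
    have h1 : (⟨γ, hγ, hlt⟩ : (A ∩ Set.Iio γ' : Set Ordinal.{u})) ≤ f ⟨γ, hγ, hlt⟩ := hf.le_apply
    exact absurd (g ⟨γ, hγ, hlt⟩).2.2 (not_lt.2 h1)
  intro γ hγ γ' hγ' h
  rcases lt_trichotomy γ γ' with hlt | heq | hlt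
  · exact absurd h (key γ hγ γ' hγ' hlt)
  · exact heq
  · exact absurd h.symm (key γ' hγ' γ hγ hlt)

theorem countable_Iio_of_lt {ν : Ordinal.{u}} (hν : ν < ω_ 1) : (Set.Iio ν).Countable := by
  rw [← Cardinal.le_aleph0_iff_set_countable, Cardinal.mk_Iio_ordinal, Cardinal.lift_le_aleph0]
  rw [← Order.lt_succ_iff, succ_aleph0, ← Cardinal.lt_ord, ord_aleph]
  exact hν

theorem countable_Iic_of_lt {ν : Ordinal.{u}} (hν : ν < ω_ 1) : (Set.Iic ν).Countable := by
  rw [← Set.Iio_insert]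
  exact (countable_Iio_of_lt hν).insert _

/-- Induction on `β`, using only the first two terms of the maximum. With `η = min (C_β \ α)`, the
sets `C_β ∩ η` and `C_β ∩ α` coincide, so `otp (C_β ∩ η) ≤ ν` leaves countably many choices for `η`.
For each of them either `α = η` or `ρ(α,η) ≤ ν`. -/
theorem countable_rho_le {C : Ordinal.{u} → Set Ordinal.{u}} (hC : IsSquareSeq C)
    {ν : Ordinal.{u}} (hν : ν < ω_ 1) (β : Ordinal.{u}) (hβ : β < ω_ 2) :
    {α | α < β ∧ rho C α β ≤ ν}.Countable := by
  induction β using WellFoundedLT.induction with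
  | ind β ih =>
    set S := {γ | γ ∈ C β ∧ otp (C β ∩ Set.Iio γ) ≤ ν} with hS
    have hSc : S.Countable := by
      refine Set.MapsTo.countable_of_injOn (t := Set.Iic ν) (fun γ hγ => hγ.2)
        ((otp_inter_Iio_injOn (C β)).mono fun γ hγ => hγ.1) (countable_Iic_of_lt hν)
    have hsub : {α | α < β ∧ rho C α β ≤ ν} ⊆
        ⋃ η ∈ S, insert η {α | α < η ∧ rho C α η ≤ ν} := by
      rintro α ⟨hαβ, hα⟩
      rw [rho_of_lt hC hαβ hβ] at hα
      obtain ⟨δ, hδ, hαδ⟩ := hC.unbounded β hβ α hαβ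
      have hm : nextStep C α β ∈ {γ | γ ∈ C β ∧ α ≤ γ} := csInf_mem ⟨δ, hδ, hαδ⟩
      have heq : C β ∩ Set.Iio (nextStep C α β) = C β ∩ Set.Iio α := by
        ext x
        refine ⟨fun hx => ⟨hx.1, ?_⟩, fun hx => ⟨hx.1, hx.2.trans_le hm.2⟩⟩
        by_contra hxα
        exact absurd (csInf_le' (s := {γ | γ ∈ C β ∧ α ≤ γ}) ⟨hx.1, not_lt.1 hxα⟩)
          (not_le.2 hx.2)
      refine Set.mem_biUnion (x := nextStep C α β)
        ⟨hm.1, heq ▸ (le_max_left _ _).trans hα⟩ ?_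
      rcases hm.2.eq_or_lt with h | h
      · exact Or.inl h
      · exact Or.inr ⟨h, (le_max_left _ _).trans ((le_max_right _ _).trans hα)⟩
    refine Set.Countable.mono hsub (hSc.biUnion fun η hη => ?_)
    have hηβ := hC.subset β hβ hη.1
    exact (ih η hηβ (lt_trans hηβ hβ)).insert _

/-! ### Definability with parameters -/

/-- `P` is definable over `H_θ` by a formula with parameters from `S`. -/
def Df (S : setLang.ElementarySubstructure (hered θ)) (P : (α → hered θ) → Prop) : Prop :=
  ∃ φ : setLang.Formula (α ⊕ S), ∀ v : α → hered θ,
    φ.Realize (Sum.elim v (fun s : S => (s : hered θ))) ↔ P v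

/-- `t` is a variable or a constant from `S`. -/
def Tm (S : setLang.ElementarySubstructure (hered θ)) (t : (α → hered θ) → hered θ) : Prop :=
  ∃ a : α ⊕ S, ∀ v : α → hered θ, Sum.elim v (fun s : S => (s : hered θ)) a = t v

theorem Tm.var (a : α) : Tm S (fun v => v a) := ⟨Sum.inl a, fun _ => rfl⟩

theorem Tm.const {m : hered θ} (hm : m ∈ S) : Tm (α := α) S (fun _ => m) :=
  ⟨Sum.inr ⟨m, hm⟩, fun _ => rfl⟩

theorem Df.mem {s t : (α → hered θ) → hered θ} (hs : Tm S s) (ht : Tm S t) :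
    Df S (fun v => (s v).1 ∈ (t v).1) := by
  obtain ⟨a, ha⟩ := hs
  obtain ⟨b, hb⟩ := ht
  refine ⟨Relations.formula₂ (L := setLang) (show setLang.Relations 2 from MemRel.mem)
    (Term.var a) (Term.var b), fun v => ?_⟩
  change _ ↔ (s v).1 ∈ (t v).1
  rw [← ha, ← hb]
  exact Formula.realize_rel₂

theorem Df.eq {s t : (α → hered θ) → hered θ} (hs : Tm S s) (ht : Tm S t) :
    Df S (fun v => s v = t v) := by
  obtain ⟨a, ha⟩ := hs
  obtain ⟨b, hb⟩ := ht
  refine ⟨Term.equal (Term.var a) (Term.var b), fun v => ?_⟩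
  change _ ↔ s v = t v
  rw [← ha, ← hb]
  simp [Formula.realize_equal]

theorem Df.not {P : (α → hered θ) → Prop} (h : Df S P) : Df S (fun v => ¬ P v) := by
  obtain ⟨φ, hφ⟩ := h
  exact ⟨φ.not, fun v => by rw [Formula.realize_not, hφ]⟩

theorem Df.and {P Q : (α → hered θ) → Prop} (h : Df S P) (h' : Df S Q) :
    Df S (fun v => P v ∧ Q v) := by
  obtain ⟨φ, hφ⟩ := h
  obtain ⟨ψ, hψ⟩ := h'
  exact ⟨φ ⊓ ψ, fun v => by rw [Formula.realize_inf, hφ, hψ]⟩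

theorem Df.congr {P Q : (α → hered θ) → Prop} (h : Df S P) (hPQ : ∀ v, Q v ↔ P v) : Df S Q := by
  rwa [show Q = P from funext fun v => propext (hPQ v)]

theorem Df.or {P Q : (α → hered θ) → Prop} (h : Df S P) (h' : Df S Q) :
    Df S (fun v => P v ∨ Q v) :=
  (h.not.and h'.not).not.congr fun v => by tauto

theorem Df.imp {P Q : (α → hered θ) → Prop} (h : Df S P) (h' : Df S Q) :
    Df S (fun v => P v → Q v) :=
  (h.not.or h').congr fun v => by tauto

theorem Df.iff {P Q : (α → hered θ) → Prop} (h : Df S P) (h' : Df S Q) :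
    Df S (fun v => P v ↔ Q v) :=
  ((h.imp h').and (h'.imp h)).congr fun v => by tauto

theorem Df.subst {P : (α → hered θ) → Prop} (h : Df S P) (σ : α → β) :
    Df S (fun w : β → hered θ => P (fun a => w (σ a))) := by
  obtain ⟨φ, hφ⟩ := h
  refine ⟨φ.relabel (Sum.map σ id), fun w => ?_⟩
  rw [Formula.realize_relabel, Sum.elim_comp_map]
  exact hφ _

theorem Df.finAll {ι : Type} [Finite ι] {P : ι → (α → hered θ) → Prop} (h : ∀ i, Df S (P i)) :
    Df S (fun v => ∀ i, P i v) := by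
  choose φ hφ using h
  exact ⟨Formula.iInf φ, fun v => by simp only [Formula.realize_iInf, hφ]⟩

theorem Df.exs [Finite β] {Q : (α → hered θ) → (β → hered θ) → Prop}
    (h : Df S (fun w : α ⊕ β → hered θ => Q (fun a => w (.inl a)) (fun b => w (.inr b)))) :
    Df S (fun v => ∃ x, Q v x) := by
  obtain ⟨φ, hφ⟩ := h
  refine ⟨(φ.relabel (Sum.elim (Sum.elim (Sum.inl ∘ Sum.inl) Sum.inr) (Sum.inl ∘ Sum.inr)) :
    setLang.Formula ((α ⊕ S) ⊕ β)).iExs β, fun v => ?_⟩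
  rw [Formula.realize_iExs]
  refine exists_congr fun x => ?_
  rw [Formula.realize_relabel]
  refine Iff.trans (iff_of_eq (congrArg _ ?_)) (hφ (Sum.elim v x))
  ext ((a | b) | s) <;> rfl

theorem Df.alls [Finite β] {Q : (α → hered θ) → (β → hered θ) → Prop}
    (h : Df S (fun w : α ⊕ β → hered θ => Q (fun a => w (.inl a)) (fun b => w (.inr b)))) :
    Df S (fun v => ∀ x, Q v x) :=
  (Df.exs (Q := fun v x => ¬ Q v x) h.not).not.congr fun _ => by push Not; rfl

theorem Df.ex {Q : (α → hered θ) → hered θ → Prop}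
    (h : Df S (fun w : α ⊕ Unit → hered θ => Q (fun a => w (.inl a)) (w (.inr ())))) :
    Df S (fun v => ∃ x, Q v x) :=
  (Df.exs (Q := fun v x => Q v (x ())) h).congr fun _ =>
    ⟨fun ⟨x, hx⟩ => ⟨fun _ => x, hx⟩, fun ⟨x, hx⟩ => ⟨x (), hx⟩⟩

theorem Df.all {Q : (α → hered θ) → hered θ → Prop}
    (h : Df S (fun w : α ⊕ Unit → hered θ => Q (fun a => w (.inl a)) (w (.inr ())))) :
    Df S (fun v => ∀ x, Q v x) :=
  (Df.ex (Q := fun v x => ¬ Q v x) h.not).not.congr fun _ => by push Not; rfl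

/-- Elementarity enters the proof only here. The parameters become free variables, the existential
formula passes from `H_θ` down to `S`, and the witnesses found in `S` pass back up. -/
theorem Df.exists_mem_pi [Finite β] {P : (β → hered θ) → Prop} (h : Df S P) (hP : ∃ x, P x) :
    ∃ x, (∀ b, x b ∈ S) ∧ P x := by
  obtain ⟨φ, hφ⟩ := h
  have h1 := S.subtype.map_formula ((φ.relabel Sum.swap : setLang.Formula (S ⊕ β)).iExs β) id
  simp only [Formula.realize_iExs, Formula.realize_relabel] at h1
  have h2 := h1.1 (by
    obtain ⟨x, hx⟩ := hP
    refine ⟨x, (iff_of_eq (congrArg _ ?_)).1 ((hφ x).2 hx)⟩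
    ext (b | s) <;> rfl)
  obtain ⟨x, hx⟩ := h2
  refine ⟨fun b => (x b : hered θ), fun b => (x b).2, (hφ _).1 ?_⟩
  rw [← S.subtype.map_formula] at hx
  refine (iff_of_eq (congrArg _ ?_)).1 hx
  ext (b | s) <;> rfl

theorem Df.exists_mem {P : hered θ → Prop} (h : Df S (fun v : Unit → hered θ => P (v ())))
    (hP : ∃ x, P x) : ∃ x ∈ S, P x := by
  obtain ⟨x, hx, h⟩ := h.exists_mem_pi (hP.imp' (fun x _ => x) fun x hx => hx)
  exact ⟨x (), hx (), h⟩

/-! ### Closure properties of `H_θ` -/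

theorem mem_hered_of_mem {x y : ZFSet.{u}} (hy : y ∈ hered θ) (h : x ∈ y) : x ∈ hered θ := by
  obtain ⟨t, ht, hyt, hc⟩ := hy
  exact ⟨t, ht, ht.subset_of_mem (hyt h), hc⟩

theorem card_lt_of_mem_hered {x : ZFSet.{u}} (hx : x ∈ hered θ) : x.card < θ := by
  obtain ⟨t, _, hxt, hc⟩ := hx
  exact (ZFSet.card_mono hxt).trans_lt hc

/-- By regularity, a union of fewer than `θ` transitive sets of size below `θ` has size below `θ`;
adding the elements of `z` keeps it transitive. -/
theorem mem_hered_of_forall (hθ : θ.IsRegular) {z : ZFSet.{u}} (hz : ∀ x ∈ z, x ∈ hered θ)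
    (hc : z.card < θ) : z ∈ hered θ := by
  have h : ∀ x : Shrink.{u} z, ((equivShrink z).symm x : ZFSet.{u}) ∈ hered θ :=
    fun x => hz _ ((equivShrink z).symm x).2
  choose t ht hxt htc using h
  have hmem : ∀ x (hx : x ∈ z), x ⊆ ZFSet.iUnion t := fun x hx y hy => by
    rw [ZFSet.mem_iUnion]
    refine ⟨equivShrink z ⟨x, hx⟩, hxt _ ?_⟩
    simpa using hy
  refine ⟨z ∪ ZFSet.iUnion t, ?_, ?_, ?_⟩
  · intro y hy w hw
    rw [ZFSet.mem_union] at hy ⊢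
    rcases hy with hy | hy
    · exact Or.inr (hmem y hy hw)
    · exact Or.inr ((ZFSet.IsTransitive.iUnion ht) y hy hw)
  · exact fun y hy => ZFSet.mem_union.2 (Or.inl hy)
  · refine ZFSet.card_union_le.trans_lt (Cardinal.add_lt_of_lt hθ.aleph0_le hc ?_)
    have h1 := ZFSet.lift_card_iUnion_le_sum_card (f := t)
    rw [Cardinal.lift_id] at h1
    refine h1.trans_lt (Cardinal.sum_lt_of_isRegular hθ hc htc)

theorem range_mem_hered (hθ : θ.IsRegular) {I : ZFSet.{u}} (hI : I.card < θ)
    (f : {x // x ∈ I} → ZFSet.{u}) (hf : ∀ i, f i ∈ hered θ) : ZFSet.range f ∈ hered θ := by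
  refine mem_hered_of_forall hθ (fun x hx => ?_) (lt_of_le_of_lt ?_ hI)
  · obtain ⟨i, rfl⟩ := ZFSet.mem_range.1 hx
    exact hf i
  · have h := ZFSet.lift_card_range_le.{u + 1, u} (f := f)
    have h2 : #{x // x ∈ I} = Cardinal.lift.{u + 1} I.card := ZFSet.cardinalMk_coe_sort
    rw [h2, Cardinal.lift_lift, Cardinal.lift_le] at h
    exact h

theorem insert_mem_hered (hθ : θ.IsRegular) {x y : ZFSet.{u}} (hx : x ∈ hered θ)
    (hy : y ∈ hered θ) : insert x y ∈ hered θ := by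
  refine mem_hered_of_forall hθ (fun z hz => ?_) (ZFSet.card_insert_le.trans_lt
    (Cardinal.add_lt_of_lt hθ.aleph0_le (card_lt_of_mem_hered hy)
      (one_lt_aleph0.trans_le hθ.aleph0_le)))
  rcases ZFSet.mem_insert_iff.1 hz with rfl | h
  · exact hx
  · exact mem_hered_of_mem hy h

theorem empty_mem_hered (hθ : θ.IsRegular) : (∅ : ZFSet.{u}) ∈ hered θ :=
  mem_hered_of_forall hθ (fun z hz => absurd hz (ZFSet.notMem_empty z))
    (by rw [ZFSet.card_empty]; exact aleph0_pos.trans_le hθ.aleph0_le)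

theorem upair_mem_hered (hθ : θ.IsRegular) {x y : ZFSet.{u}} (hx : x ∈ hered θ)
    (hy : y ∈ hered θ) : ({x, y} : ZFSet.{u}) ∈ hered θ := by
  refine insert_mem_hered hθ hx ?_
  rw [← insert_empty_eq]
  exact insert_mem_hered hθ hy (empty_mem_hered hθ)

theorem pair_mem_hered (hθ : θ.IsRegular) {x y : ZFSet.{u}} (hx : x ∈ hered θ)
    (hy : y ∈ hered θ) : ZFSet.pair x y ∈ hered θ := by
  refine upair_mem_hered hθ ?_ (upair_mem_hered hθ hx hy)
  rw [← insert_empty_eq]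
  exact insert_mem_hered hθ hx (empty_mem_hered hθ)

theorem toZFSet_mem_hered {a : Ordinal.{u}} (ha : a.card < θ) : a.toZFSet ∈ hered θ :=
  ⟨a.toZFSet, (ZFSet.isOrdinal_toZFSet a).isTransitive, fun _ h => h, by
    rwa [Ordinal.card_toZFSet]⟩

/-- `H_θ` is transitive, so quantifiers over `H_θ` suffice to pin down a set by its elements. This
makes the formulas below define the true pairs and successors. -/
theorem hered_ext {x y : ZFSet.{u}} (hx : x ∈ hered θ) (hy : y ∈ hered θ)
    (h : ∀ z : hered θ, z.1 ∈ x ↔ z.1 ∈ y) : x = y :=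
  ZFSet.ext fun z => ⟨fun hz => (h ⟨z, mem_hered_of_mem hx hz⟩).1 hz,
    fun hz => (h ⟨z, mem_hered_of_mem hy hz⟩).2 hz⟩

/-! ### Definability of pairs -/

theorem Tm.lift {t : (α → hered θ) → hered θ} (ht : Tm S t) :
    Tm S (fun w : α ⊕ β → hered θ => t (fun a => w (.inl a))) := by
  obtain ⟨a | s, h⟩ := ht
  · exact ⟨.inl (.inl a), fun v => h fun a => v (.inl a)⟩
  · exact ⟨.inr s, fun v => h fun a => v (.inl a)⟩

theorem Df.upair (hθ : θ.IsRegular) {s t r : (α → hered θ) → hered θ} (hs : Tm S s) (ht : Tm S t)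
    (hr : Tm S r) : Df S (fun v => (r v).1 = ({(s v).1, (t v).1} : ZFSet.{u})) := by
  refine Df.congr (P := fun v => ∀ z : hered θ, z.1 ∈ (r v).1 ↔ (z = s v ∨ z = t v))
    (.all ((Df.mem (.var _) hr.lift).iff ((Df.eq (.var _) hs.lift).or (.eq (.var _) ht.lift))))
    fun v => ⟨fun h z => ?_, fun h => ?_⟩
  · rw [h, ZFSet.mem_pair, Subtype.ext_iff, Subtype.ext_iff]
  · refine hered_ext (r v).2 (upair_mem_hered hθ (s v).2 (t v).2) fun z => ?_
    rw [h z, ZFSet.mem_pair, Subtype.ext_iff, Subtype.ext_iff]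

theorem Df.eq_pair (hθ : θ.IsRegular) {s t r : (α → hered θ) → hered θ} (hs : Tm S s)
    (ht : Tm S t) (hr : Tm S r) : Df S (fun v => (r v).1 = ZFSet.pair (s v).1 (t v).1) := by
  -- The singleton in the Kuratowski pair is written `{x, x}`, so that unordered pairs are the only
  -- ingredient.
  refine Df.congr (P := fun v => ∃ a b : hered θ, a.1 = ({(s v).1, (s v).1} : ZFSet.{u}) ∧
      b.1 = ({(s v).1, (t v).1} : ZFSet.{u}) ∧ (r v).1 = ({a.1, b.1} : ZFSet.{u}))
    (.ex (.ex ((Df.upair hθ hs.lift.lift hs.lift.lift (.var _)).and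
      ((Df.upair hθ hs.lift.lift ht.lift.lift (.var _)).and
        (Df.upair hθ (.var _) (.var _) hr.lift.lift)))))
    fun v => ⟨fun h => ?_, ?_⟩
  · refine ⟨⟨_, upair_mem_hered hθ (s v).2 (s v).2⟩, ⟨_, upair_mem_hered hθ (s v).2 (t v).2⟩,
      rfl, rfl, ?_⟩
    change (r v).1 = {{(s v).1, (s v).1}, {(s v).1, (t v).1}}
    rw [h, ZFSet.pair, ZFSet.pair_eq_singleton]
  · rintro ⟨a, b, ha, hb, h⟩
    rw [h, ha, hb, ZFSet.pair, ZFSet.pair_eq_singleton]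

theorem Df.pair_mem (hθ : θ.IsRegular) {s t r : (α → hered θ) → hered θ} (hs : Tm S s)
    (ht : Tm S t) (hr : Tm S r) : Df S (fun v => ZFSet.pair (s v).1 (t v).1 ∈ (r v).1) := by
  refine Df.congr (P := fun v => ∃ a : hered θ, a.1 = ZFSet.pair (s v).1 (t v).1 ∧ a.1 ∈ (r v).1)
    (.ex ((Df.eq_pair hθ hs.lift ht.lift (.var _)).and (.mem (.var _) hr.lift)))
    fun v => ⟨fun h => ⟨⟨_, mem_hered_of_mem (r v).2 h⟩, rfl, h⟩, ?_⟩
  rintro ⟨a, ha, h⟩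
  rwa [← ha]

theorem Df.triple_mem (hθ : θ.IsRegular) {s t x r : (α → hered θ) → hered θ} (hs : Tm S s)
    (ht : Tm S t) (hx : Tm S x) (hr : Tm S r) :
    Df S (fun v => ZFSet.pair (ZFSet.pair (s v).1 (t v).1) (x v).1 ∈ (r v).1) := by
  refine Df.congr (P := fun v => ∃ a : hered θ, a.1 = ZFSet.pair (s v).1 (t v).1 ∧
      ZFSet.pair a.1 (x v).1 ∈ (r v).1)
    (.ex ((Df.eq_pair hθ hs.lift ht.lift (.var _)).and (.pair_mem hθ (.var _) hx.lift hr.lift)))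
    fun v => ⟨fun h => ⟨⟨_, pair_mem_hered hθ (s v).2 (t v).2⟩, rfl, h⟩, ?_⟩
  rintro ⟨a, ha, h⟩
  rwa [← ha]

/-- If every point is `E`-related to a value of some function on a set `I` of the model `S`, then
every point is `E`-related to an element of any larger model that contains the elements
of `I`. -/
theorem exists_related_mem [Finite β] (hθ : θ.IsRegular) {I : hered θ} (hI : I ∈ S)
    {E : (β → hered θ) → (β → hered θ) → Prop}
    (hE : Df S (fun w : β ⊕ β → hered θ => E (fun b => w (.inl b)) (fun b => w (.inr b))))
    (f : {x // x ∈ I.1} → β → hered θ) (hf : ∀ x, ∃ i, E x (f i)) :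
    ∀ x, ∃ i : hered θ, i.1 ∈ I.1 ∧
      ∀ T : setLang.ElementarySubstructure (hered θ), (∀ z ∈ S, z ∈ T) → i ∈ T →
        ∃ y, (∀ b, y b ∈ T) ∧ E x y := by
  have hIH : ∀ i : {x // x ∈ I.1}, i.1 ∈ hered θ := fun i => mem_hered_of_mem I.2 i.2
  -- The family `f` itself need not lie in `S`. Its graphs, one for each coordinate, witness an
  -- existential statement in `H_θ`, so graphs `e` with the same property exist in `S`.
  obtain ⟨e, heS, he, hfun⟩ := Df.exists_mem_pi (S := S) (β := β)
    (P := fun e => (∀ x : β → hered θ, ∃ i : hered θ, i.1 ∈ I.1 ∧ ∃ y : β → hered θ,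
        (∀ b, ZFSet.pair i.1 (y b).1 ∈ (e b).1) ∧ E x y) ∧
      ∀ b, ∀ i y y' : hered θ, ZFSet.pair i.1 y.1 ∈ (e b).1 → ZFSet.pair i.1 y'.1 ∈ (e b).1 →
        y = y')
    (by
      refine .and (.alls (.ex (.and (.mem (.var _) (.const hI)) (.exs (.and ?_ ?_)))))
        (.finAll fun b => .all (.all (.all (.imp ?_ (.imp ?_ (.eq (.var _) (.var _)))))))
      · exact .finAll fun b => .pair_mem hθ (.var _) (.var _) (.var _)
      · exact hE.subst (Sum.elim (fun b => Sum.inl (Sum.inl (Sum.inr b))) Sum.inr)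
      · exact .pair_mem hθ (.var _) (.var _) (.var _)
      · exact .pair_mem hθ (.var _) (.var _) (.var _))
    (by
      have hmem : ∀ b (i y : ZFSet.{u}), ZFSet.pair i y ∈
          ZFSet.range (fun i : {x // x ∈ I.1} => ZFSet.pair i.1 (f i b).1) ↔
          ∃ h : i ∈ I.1, (f ⟨i, h⟩ b).1 = y := fun b i y => by
        rw [ZFSet.mem_range]
        constructor
        · rintro ⟨j, hj⟩
          obtain ⟨rfl, h⟩ := ZFSet.pair_inj.1 hj
          exact ⟨j.2, h⟩
        · rintro ⟨h, rfl⟩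
          exact ⟨⟨i, h⟩, rfl⟩
      refine ⟨fun b => ⟨ZFSet.range fun i : {x // x ∈ I.1} => ZFSet.pair i.1 (f i b).1,
        range_mem_hered hθ (card_lt_of_mem_hered I.2) _
          fun i => pair_mem_hered hθ (hIH i) (f i b).2⟩, fun x => ?_, fun b i y y' h h' => ?_⟩
      · obtain ⟨i, hi⟩ := hf x
        exact ⟨⟨i.1, hIH i⟩, i.2, f i, fun b => (hmem _ _ _).2 ⟨i.2, rfl⟩, hi⟩
      · obtain ⟨_, h⟩ := (hmem _ _ _).1 h
        obtain ⟨_, h'⟩ := (hmem _ _ _).1 h'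
        exact Subtype.ext (h.symm.trans h'))
  intro x
  obtain ⟨i, hi, y, hy, hxy⟩ := he x
  refine ⟨i, hi, fun T hST hiT => ⟨y, fun b => ?_, hxy⟩⟩
  -- The value of `e b` at `i` is definable from `e b` and `i`, both in `T`; single-valuedness
  -- identifies the witness with `y b`.
  obtain ⟨z, hz, h⟩ := Df.exists_mem (S := T) (P := fun z => ZFSet.pair i.1 z.1 ∈ (e b).1)
    (.pair_mem hθ (.const hiT) (.var _) (.const (hST _ (heS b)))) ⟨y b, hy b⟩
  rwa [hfun b i _ _ (hy b) h]

/-! ### Definability of the empty set and of successors -/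

theorem Df.eq_empty {t : (α → hered θ) → hered θ} (ht : Tm S t) :
    Df S (fun v => (t v).1 = ∅) := by
  refine Df.congr (P := fun v => ∀ z : hered θ, ¬ z.1 ∈ (t v).1)
    (.all (.not (.mem (.var _) ht.lift))) fun v => ⟨fun h z => ?_, fun h => ?_⟩
  · rw [h]
    exact ZFSet.notMem_empty _
  · rw [ZFSet.eq_empty]
    exact fun y hy => h ⟨y, mem_hered_of_mem (t v).2 hy⟩ hy

theorem Df.eq_succ (hθ : θ.IsRegular) {s t : (α → hered θ) → hered θ} (hs : Tm S s)
    (ht : Tm S t) : Df S (fun v => (s v).1 = insert (t v).1 (t v).1) := by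
  refine Df.congr (P := fun v => ∀ z : hered θ, z.1 ∈ (s v).1 ↔ (z = t v ∨ z.1 ∈ (t v).1))
    (.all ((Df.mem (.var _) hs.lift).iff ((Df.eq (.var _) ht.lift).or (.mem (.var _) ht.lift))))
    fun v => ⟨fun h z => ?_, fun h => ?_⟩
  · rw [h, ZFSet.mem_insert_iff, Subtype.ext_iff]
  · refine hered_ext (s v).2 (insert_mem_hered hθ (t v).2 (t v).2) fun z => ?_
    rw [h z, ZFSet.mem_insert_iff, Subtype.ext_iff]

/-! ### Ordinals in elementary submodels -/

/-- The set `x` is (coded by) an element of the model `S`. -/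
def InModel (S : setLang.ElementarySubstructure (hered θ)) (x : ZFSet.{u}) : Prop :=
  ∃ y ∈ S, y.1 = x

theorem InModel.mem {x : hered θ} (h : InModel S x.1) : x ∈ S := by
  obtain ⟨y, hy, h⟩ := h
  rwa [← Subtype.ext h]

theorem InModel.of_definable {P : hered θ → Prop} {x : ZFSet.{u}} (hx : x ∈ hered θ)
    (h : Df S (fun v : Unit → hered θ => P (v ()))) (hP : P ⟨x, hx⟩)
    (hu : ∀ y, P y → y.1 = x) : InModel S x := by
  obtain ⟨y, hy, h⟩ := h.exists_mem ⟨_, hP⟩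
  exact ⟨y, hy, hu y h⟩

theorem InModel.insert_self (hθ : θ.IsRegular) {x : ZFSet.{u}} (hx : InModel S x) :
    InModel S (insert x x) := by
  obtain ⟨x, hx, rfl⟩ := hx
  exact .of_definable (P := fun y => y.1 = insert x.1 x.1) (insert_mem_hered hθ x.2 x.2)
    (.eq_succ hθ (.var _) (.const hx)) rfl fun _ h => h

theorem InModel.add_one (hθ : θ.IsRegular) {a : Ordinal.{u}} (ha : InModel S a.toZFSet) :
    InModel S (a + 1).toZFSet := by
  rw [toZFSet_add_one]
  exact ha.insert_self hθ

theorem inModel_natCast (hθ : θ.IsRegular) (n : ℕ) : InModel S (n : Ordinal.{u}).toZFSet := by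
  induction n with
  | zero =>
    rw [Nat.cast_zero, toZFSet_zero]
    exact .of_definable (P := fun y => y.1 = ∅) (empty_mem_hered hθ) (.eq_empty (.var _)) rfl
      fun _ h => h
  | succ n ih =>
    rw [Nat.cast_succ]
    exact ih.add_one hθ

/-- `z` is an inductive set. -/
def IsInductive (z : hered θ) : Prop :=
  (∀ y : hered θ, y.1 = ∅ → y.1 ∈ z.1) ∧
    ∀ y s : hered θ, y.1 ∈ z.1 → s.1 = insert y.1 y.1 → s.1 ∈ z.1

theorem Df.isInductive (hθ : θ.IsRegular) {t : (α → hered θ) → hered θ} (ht : Tm S t) :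
    Df S (fun v => IsInductive (t v)) :=
  Df.and (.all ((Df.eq_empty (.var _)).imp (.mem (.var _) ht.lift)))
    (.all (.all ((Df.mem (.var _) ht.lift.lift).imp
      ((Df.eq_succ hθ (.var _) (.var _)).imp (.mem (.var _) ht.lift.lift)))))

theorem IsInductive.natCast_mem (hθ : θ.IsRegular) {z : hered θ} (hz : IsInductive z) (n : ℕ) :
    (n : Ordinal.{u}).toZFSet ∈ z.1 := by
  induction n with
  | zero =>
    rw [Nat.cast_zero, toZFSet_zero]
    exact hz.1 ⟨∅, empty_mem_hered hθ⟩ rfl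
  | succ n ih =>
    rw [Nat.cast_succ, toZFSet_add_one]
    have h := mem_hered_of_mem z.2 ih
    exact hz.2 ⟨_, h⟩ ⟨_, insert_mem_hered hθ h h⟩ ih rfl

/-- `ω` is definable without parameters as the least inductive set. -/
theorem inModel_omega0 (hθ : θ.IsRegular) (hθ' : ℵ₀ < θ) :
    InModel S (ω : Ordinal.{u}).toZFSet := by
  have hω : (ω : Ordinal.{u}).toZFSet ∈ hered θ := toZFSet_mem_hered (by rwa [card_omega0])
  have hle : ∀ z : hered θ, IsInductive z → ∀ t : hered θ, t.1 ∈ (ω : Ordinal.{u}).toZFSet →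
      t.1 ∈ z.1 := by
    intro z hz t ht
    obtain ⟨a, ha, h⟩ := mem_toZFSet_iff.1 ht
    obtain ⟨n, rfl⟩ := lt_omega0.1 ha
    exact h ▸ hz.natCast_mem hθ n
  have hind : IsInductive (⟨_, hω⟩ : hered θ) := by
    refine ⟨fun y hy => ?_, fun y s hy hs => ?_⟩
    · rw [hy, ← toZFSet_zero]
      exact toZFSet_mem_toZFSet_iff.2 omega0_pos
    · obtain ⟨a, ha, h⟩ := mem_toZFSet_iff.1 hy
      rw [hs, ← h, ← toZFSet_add_one]
      exact toZFSet_mem_toZFSet_iff.2 (isSuccLimit_omega0.succ_lt ha)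
  refine .of_definable (P := fun x => IsInductive x ∧ ∀ z, IsInductive z →
    ∀ t : hered θ, t.1 ∈ x.1 → t.1 ∈ z.1) hω ?_ ⟨hind, hle⟩ fun y hy => ?_
  · exact (Df.isInductive hθ (.var _)).and (.all ((Df.isInductive hθ (.var _)).imp
      (.all ((Df.mem (.var _) (.var _)).imp (.mem (.var _) (.var _))))))
  · exact hered_ext y.2 hω fun t => ⟨hy.2 ⟨_, hω⟩ hind t, hle y hy.1 t⟩

theorem exists_surjective_of_card_le {X : Type (u + 1)} [Nonempty X] {I : ZFSet.{u}}
    (h : #X ≤ Cardinal.lift.{u + 1} I.card) :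
    ∃ f : {x // x ∈ I} → X, Function.Surjective f := by
  have h2 : #{x // x ∈ I} = Cardinal.lift.{u + 1} I.card := ZFSet.cardinalMk_coe_sort
  rw [← h2] at h
  obtain ⟨e⟩ := h
  exact ⟨Function.invFun e, Function.invFun_surjective e.injective⟩

/-- By elementarity `S` has an enumeration of `A` along `ω`. Every natural number lies in `S`, and
hence so does every value. -/
theorem InModel.subset_of_countable (hθ : θ.IsRegular) (hθ' : ℵ₀ < θ) {A : ZFSet.{u}}
    (hA : InModel S A) (hc : A.card ≤ ℵ₀) {x : ZFSet.{u}} (hx : x ∈ A) : InModel S x := by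
  obtain ⟨ω', hω, hωe⟩ := inModel_omega0 (S := S) hθ hθ'
  obtain ⟨A, hAS, rfl⟩ := hA
  have : Nonempty {x // x ∈ A.1} := ⟨⟨x, hx⟩⟩
  obtain ⟨f, hf⟩ := exists_surjective_of_card_le (X := {x // x ∈ A.1}) (I := ω'.1) (by
    have h2 : #{x // x ∈ A.1} = Cardinal.lift.{u + 1} A.1.card := ZFSet.cardinalMk_coe_sort
    rw [h2, hωe, card_toZFSet, card_omega0]
    exact Cardinal.lift_le.2 hc)
  obtain ⟨i, hi, h⟩ := exists_related_mem (β := Unit) hθ hω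
    -- Points outside `A` are related to everything, which makes `E` total; on `A` the relation is
    -- equality.
    (E := fun x y => (x ()).1 ∈ A.1 → x () = y ())
    ((Df.mem (.var _) (.const hAS)).imp (.eq (.var _) (.var _)))
    (fun i _ => ⟨(f i).1, mem_hered_of_mem A.2 (f i).2⟩)
    (fun x' => by
      by_cases hxA : (x' ()).1 ∈ A.1
      · obtain ⟨i, hi⟩ := hf ⟨_, hxA⟩
        refine ⟨i, fun _ => Subtype.ext ?_⟩
        rw [hi]
      · obtain ⟨i, -⟩ := hf ⟨x, hx⟩
        exact ⟨i, fun h => absurd h hxA⟩)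
    (fun _ => ⟨x, mem_hered_of_mem A.2 hx⟩)
  obtain ⟨a, ha, hai⟩ := mem_toZFSet_iff.1 (hωe ▸ hi)
  obtain ⟨n, rfl⟩ := lt_omega0.1 ha
  obtain ⟨y, hy, hxy⟩ := h S (fun _ h => h) (InModel.mem (hai ▸ inModel_natCast hθ n))
  exact ⟨y (), hy (), (congrArg Subtype.val (hxy hx)).symm⟩

/-- `f` is the graph of a partial function from `w` onto a set that covers `x`. -/
def Enumerates (w f x : hered θ) : Prop :=
  (∀ y : hered θ, y.1 ∈ x.1 → ∃ n : hered θ, n.1 ∈ w.1 ∧ ZFSet.pair n.1 y.1 ∈ f.1) ∧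
    ∀ n y y' : hered θ, ZFSet.pair n.1 y.1 ∈ f.1 → ZFSet.pair n.1 y'.1 ∈ f.1 → y = y'

theorem Df.enumerates (hθ : θ.IsRegular) {t r s : (α → hered θ) → hered θ} (ht : Tm S t)
    (hr : Tm S r) (hs : Tm S s) : Df S (fun v => Enumerates (t v) (r v) (s v)) :=
  Df.and
    (.all ((Df.mem (.var _) hs.lift).imp (.ex ((Df.mem (.var _) ht.lift.lift).and
      (.pair_mem hθ (.var _) (.var _) hr.lift.lift)))))
    (.all (.all (.all ((Df.pair_mem hθ (.var _) (.var _) hr.lift.lift.lift).imp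
      ((Df.pair_mem hθ (.var _) (.var _) hr.lift.lift.lift).imp (.eq (.var _) (.var _)))))))

/-- This makes comparison of cardinalities expressible in `H_θ`: choosing preimages gives an
injection, and conversely the graph of a surjection from `w` onto `x` belongs to `H_θ`. For empty
`x` the empty graph serves. -/
theorem exists_enumerates_iff (hθ : θ.IsRegular) {w x : hered θ} :
    (∃ f, Enumerates w f x) ↔ x.1.card ≤ w.1.card := by
  have hc : ∀ z : hered θ, #{y // y ∈ z.1} = Cardinal.lift.{u + 1} z.1.card :=
    fun z => ZFSet.cardinalMk_coe_sort
  constructor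
  · rintro ⟨f, hf, hfun⟩
    choose n hnw hn using fun y : {y // y ∈ x.1} => hf ⟨y.1, mem_hered_of_mem x.2 y.2⟩ y.2
    rw [← Cardinal.lift_le.{u + 1}, ← hc, ← hc]
    refine Cardinal.mk_le_of_injective (f := fun y => (⟨(n y).1, hnw y⟩ : {y // y ∈ w.1})) ?_
    intro y y' h
    have h' : (n y) = n y' := Subtype.ext (congrArg (fun z => z.1) h)
    have h1 := hn y
    rw [h'] at h1
    exact Subtype.ext (Subtype.mk.inj (hfun _ _ _ h1 (hn y')))
  · intro h
    by_cases hne : Nonempty {y // y ∈ x.1}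
    · obtain ⟨f, hf⟩ := exists_surjective_of_card_le (X := {y // y ∈ x.1}) (I := w.1) (by
        rw [hc]
        exact Cardinal.lift_le.2 h)
      refine ⟨⟨_, range_mem_hered hθ (card_lt_of_mem_hered w.2)
        (fun i => ZFSet.pair i.1 (f i).1) fun i => pair_mem_hered hθ
          (mem_hered_of_mem w.2 i.2) (mem_hered_of_mem x.2 (f i).2)⟩,
        fun y hy => ?_, fun n y y' h h' => ?_⟩
      · obtain ⟨i, hi⟩ := hf ⟨y.1, hy⟩
        refine ⟨⟨i.1, mem_hered_of_mem w.2 i.2⟩, i.2, ZFSet.mem_range.2 ⟨i, ?_⟩⟩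
        rw [hi]
      · obtain ⟨i, hi⟩ := ZFSet.mem_range.1 h
        obtain ⟨j, hj⟩ := ZFSet.mem_range.1 h'
        obtain ⟨h1, h2⟩ := ZFSet.pair_inj.1 hi
        obtain ⟨h3, h4⟩ := ZFSet.pair_inj.1 hj
        have hij : i = j := Subtype.ext (h1.trans h3.symm)
        subst hij
        exact Subtype.ext (h2.symm.trans h4)
    · refine ⟨⟨∅, empty_mem_hered hθ⟩, fun y hy => absurd ⟨⟨y.1, hy⟩⟩ hne,
        fun n y y' h => absurd h (ZFSet.notMem_empty _)⟩

/-! ### The graph of `ρ` in elementary submodels -/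

theorem triple_mem_funGraph_iff {x y z : ZFSet.{u}} :
    ZFSet.pair (ZFSet.pair x y) z ∈ funGraph ρ ↔ ∃ a b, a < b ∧ b < ω_ 2 ∧
      a.toZFSet = x ∧ b.toZFSet = y ∧ (ρ a b).toZFSet = z := by
  rw [funGraph, ZFSet.mem_range]
  simp only [ZFSet.pair_inj]
  constructor
  · rintro ⟨⟨⟨⟨a, ha⟩, ⟨b, hb⟩⟩, hab⟩, ⟨h1, h2⟩, h3⟩
    exact ⟨a, b, hab, hb, h1, h2, h3⟩
  · rintro ⟨a, b, hab, hb, h1, h2, h3⟩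
    exact ⟨⟨⟨⟨a, hab.trans hb⟩, ⟨b, hb⟩⟩, hab⟩, ⟨h1, h2⟩, h3⟩

/-- `x` is the first coordinate of the first coordinate of an element of `R`. -/
def InDom (R x : hered θ) : Prop :=
  ∃ y z : hered θ, ZFSet.pair (ZFSet.pair x.1 y.1) z.1 ∈ R.1

theorem Df.inDom (hθ : θ.IsRegular) {r t : (α → hered θ) → hered θ} (hr : Tm S r) (ht : Tm S t) :
    Df S (fun v => InDom (r v) (t v)) :=
  .ex (.ex (.triple_mem hθ ht.lift.lift (.var _) (.var _) hr.lift.lift))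

theorem mem_hered_of_pair_mem {x y z : ZFSet.{u}} (hz : z ∈ hered θ) (h : ZFSet.pair x y ∈ z) :
    x ∈ hered θ ∧ y ∈ hered θ := by
  have h1 := mem_hered_of_mem hz h
  have h2 : ({x, y} : ZFSet.{u}) ∈ hered θ :=
    mem_hered_of_mem h1 (ZFSet.mem_pair.2 (Or.inr rfl))
  exact ⟨mem_hered_of_mem h2 (ZFSet.mem_pair.2 (Or.inl rfl)),
    mem_hered_of_mem h2 (ZFSet.mem_pair.2 (Or.inr rfl))⟩

/-- The graph of `ρ` makes "ordinal below `ω₂`" definable without naming `ω₂`: every `a < ω₂` occurs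
in the pair `(a, a + 1)`, because `ω₂` is a limit. -/
theorem inDom_iff {R x : hered θ}
    (hR : R.1 = funGraph ρ) : InDom R x ↔ ∃ a < ω_ 2, a.toZFSet = x.1 := by
  constructor
  · rintro ⟨y, z, h⟩
    rw [hR, triple_mem_funGraph_iff] at h
    obtain ⟨a, b, hab, hb, h1, -⟩ := h
    exact ⟨a, hab.trans hb, h1⟩
  · rintro ⟨a, ha, h⟩
    have h1 : ZFSet.pair (ZFSet.pair x.1 (Order.succ a).toZFSet) (ρ a (Order.succ a)).toZFSet ∈
        R.1 := by
      rw [hR, triple_mem_funGraph_iff]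
      exact ⟨a, _, Order.lt_succ a, (Cardinal.isSuccLimit_omega 2).succ_lt ha, h, rfl, rfl⟩
    have h2 := mem_hered_of_pair_mem R.2 h1
    have h3 := mem_hered_of_mem R.2 h1
    have h4 : ({ZFSet.pair x.1 (Order.succ a).toZFSet} : ZFSet.{u}) ∈ hered θ :=
      mem_hered_of_mem h3 (ZFSet.mem_pair.2 (Or.inl rfl))
    have h5 := mem_hered_of_pair_mem h4 (ZFSet.mem_singleton.2 rfl)
    exact ⟨⟨_, h5.2⟩, ⟨_, h2.2⟩, h1⟩

theorem card_le_aleph0_iff_lt_omega_one {a : Ordinal.{u}} : a.card ≤ ℵ₀ ↔ a < ω_ 1 := by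
  rw [← Order.lt_succ_iff, succ_aleph0, ← Cardinal.lt_ord, ord_aleph]

/-- Among the ordinals below `ω₂`, only `ω₁` is uncountable with all elements countable, and
countability is expressed by enumerations along `ω`. -/
theorem inModel_omega_one (hθ : θ.IsRegular) (hθ' : ℵ_ 2 < θ)
    (hR : InModel S (funGraph ρ)) :
    InModel S (ω_ 1 : Ordinal.{u}).toZFSet := by
  have h0 : ℵ₀ < θ := (aleph0_le_aleph 2).trans_lt hθ'
  have h12 : (ω_ 1 : Ordinal.{u}) < ω_ 2 := omega_lt_omega.2 (by norm_num)
  obtain ⟨w, hw, hwe⟩ := inModel_omega0 (S := S) hθ h0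
  obtain ⟨R, hRS, hRe⟩ := hR
  have hcw : w.1.card = ℵ₀ := by rw [hwe, card_toZFSet, card_omega0]
  have hω : (ω_ 1 : Ordinal.{u}).toZFSet ∈ hered θ := toZFSet_mem_hered (by
    rw [card_omega]
    exact (aleph_le_aleph.2 (by norm_num)).trans_lt hθ')
  refine .of_definable (P := fun x => InDom R x ∧ (¬ ∃ f, Enumerates w f x) ∧
    ∀ y : hered θ, y.1 ∈ x.1 → ∃ f, Enumerates w f y) hω ?_ ⟨?_, ?_, ?_⟩ ?_
  · exact (Df.inDom hθ (.const hRS) (.var _)).and ((Df.not (.ex (.enumerates hθ (.const hw)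
      (.var _) (.var _)))).and (.all ((Df.mem (.var _) (.var _)).imp
        (.ex (.enumerates hθ (.const hw) (.var _) (.var _))))))
  · exact (inDom_iff hRe).2 ⟨_, h12, rfl⟩
  · rw [exists_enumerates_iff hθ, hcw, card_toZFSet, card_le_aleph0_iff_lt_omega_one]
    exact lt_irrefl _
  · intro y hy
    obtain ⟨a, ha, h⟩ := mem_toZFSet_iff.1 hy
    rwa [exists_enumerates_iff hθ, hcw, ← h, card_toZFSet, card_le_aleph0_iff_lt_omega_one]
  · rintro y ⟨h1, h2, h3⟩
    obtain ⟨a, ha, h⟩ := (inDom_iff hRe).1 h1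
    rw [exists_enumerates_iff hθ, hcw, ← h, card_toZFSet, card_le_aleph0_iff_lt_omega_one,
      not_lt] at h2
    rcases h2.eq_or_lt with h4 | h4
    · rw [← h, h4]
    · have h5 := h3 ⟨_, hω⟩ (by rw [← h]; exact toZFSet_mem_toZFSet_iff.2 h4)
      rw [exists_enumerates_iff hθ, hcw, card_toZFSet, card_le_aleph0_iff_lt_omega_one] at h5
      exact absurd h5 (lt_irrefl _)

/-! ### Amalgamation of conditions -/

/-- Patterns record only the values of `ρ` below `ν`. That is enough to transfer a bound from below
by `x < ν`: a value `b < x` would be recorded and force `a = b`. -/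
theorem le_of_forall_eq_iff {x ν a b : Ordinal.{u}} (hx : x < ν)
    (h : ∀ ξ < ν, a = ξ ↔ b = ξ) (hxa : x ≤ a) : x ≤ b := by
  by_contra hlt
  have hb := lt_trans (not_le.1 hlt) hx
  rw [(h b hb).2 rfl] at hxa
  exact hlt hxa

/-- Suppose that `q` has the members `β j` of its domain at or above `μ`, and that the `β' j` below
`μ` have the same pattern as the `β j` as far as values of `ρ` below `ν` are concerned. Then moving
`β j` to `β' j` turns `q` into a reduction of `q` to the conditions on `μ`. -/
theorem exists_reduction_of_copy {ι : Type*} [Finite ι] (q : Cond ρ) {μ γ ν : Ordinal.{u}}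
    (β β' : ι → Ordinal.{u})
    (hinj : Function.Injective β) (hβ : ∀ b, (b ∈ q.dom ∧ μ ≤ b) ↔ ∃ j, β j = b)
    (hβ' : ∀ j, γ < β' j ∧ β' j < μ)
    (hγ : ∀ a ∈ q.dom, a < μ → a < γ) (hν : ∀ b ∈ q.dom, ∀ x ∈ q.val b, x < ν)
    (hbig : ∀ j, ∀ a < μ, γ ≤ a → ν ≤ ρ a (β j))
    (hlow : ∀ j, ∀ a < γ, ∀ ξ < ν, ρ a (β j) = ξ ↔ ρ a (β' j) = ξ)
    (hlt : ∀ i j, β i < β j ↔ β' i < β' j)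
    (hhigh : ∀ i j, β i < β j → ∀ ξ < ν, ρ (β i) (β j) = ξ ↔ ρ (β' i) (β' j) = ξ) :
    ∃ p ∈ condOn ρ (Set.Iio μ), ∀ r ∈ condOn ρ (Set.Iio μ), r ≤ p → ∃ s, s ≤ r ∧ s ≤ q := by
  classical
  cases nonempty_fintype ι
  have hinj' : Function.Injective β' := by
    intro i j h
    refine hinj (le_antisymm (not_lt.1 fun h' => ?_) (not_lt.1 fun h' => ?_))
    · exact absurd ((hlt j i).1 h') (h ▸ lt_irrefl _)
    · exact absurd ((hlt i j).1 h') (h ▸ lt_irrefl _)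
  have hβμ : ∀ j, β j ∈ q.dom ∧ μ ≤ β j := fun j => (hβ _).2 ⟨j, rfl⟩
  -- `π` sends each copy back to its original and fixes everything below `γ`; `σ` sends originals to
  -- copies and fixes everything below `μ`.
  obtain ⟨π, hπ, hπ'⟩ : ∃ π : Ordinal.{u} → Ordinal.{u},
      (∀ j, π (β' j) = β j) ∧ ∀ a < γ, π a = a := by
    refine ⟨Function.extend β' β id, fun j => hinj'.extend_apply _ _ _, fun a ha => ?_⟩
    refine Function.extend_apply' _ _ _ ?_
    rintro ⟨j, rfl⟩
    exact lt_asymm ha (hβ' j).1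
  obtain ⟨σ, hσ, hσ'⟩ : ∃ σ : Ordinal.{u} → Ordinal.{u},
      (∀ j, σ (β j) = β' j) ∧ ∀ a < μ, σ a = a := by
    refine ⟨Function.extend β β' id, fun j => hinj.extend_apply _ _ _, fun a ha => ?_⟩
    refine Function.extend_apply' _ _ _ ?_
    rintro ⟨j, rfl⟩
    exact not_le.2 ha (hβμ j).2
  let D : Finset Ordinal.{u} := q.dom.filter (· < μ) ∪ Finset.univ.image β'
  have hD : ∀ a, a ∈ D ↔ (a ∈ q.dom ∧ a < μ) ∨ ∃ j, β' j = a := fun a => by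
    simp [D]
  have hDμ : ∀ a ∈ D, a < μ := fun a ha => by
    rcases (hD a).1 ha with h | ⟨j, rfl⟩
    exacts [h.2, (hβ' j).2]
  have hDπ : ∀ a ∈ D, π a ∈ q.dom := fun a ha => by
    rcases (hD a).1 ha with h | ⟨j, rfl⟩
    · rw [hπ' a (hγ a h.1 h.2)]
      exact h.1
    · rw [hπ]
      exact (hβμ j).1
  have hDlt : ∀ a ∈ D, a < ω_ 2 := fun a ha => by
    rcases (hD a).1 ha with h | ⟨j, rfl⟩
    · exact q.dom_lt a h.1
    · exact (hβ' j).2.trans_le ((hβμ j).2.trans (q.dom_lt _ (hβμ j).1).le)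
  let p : Cond ρ :=
    { dom := D
      val := fun a => if a ∈ D then q.val (π a) else ∅
      val_off := fun a ha => if_neg ha
      dom_lt := hDlt
      val_lt := fun a ha x hx => by
        rw [if_pos ha] at hx
        exact q.val_lt _ (hDπ a ha) x hx
      level := fun a ha => by
        simp only [if_pos ha]
        exact q.level _ (hDπ a ha)
      initial := fun a ha b hb => by
        simp only [if_pos ha, if_pos hb]
        exact q.initial _ (hDπ a ha) _ (hDπ b hb)
      delta := fun a ha b hb hab x => by
        simp only [if_pos ha, if_pos hb]
        intro hx
        have hxν : x < ν := hν _ (hDπ a ha) x (Finset.mem_inter.1 hx).1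
        have key := q.delta _ (hDπ a ha) _ (hDπ b hb)
        rcases (hD a).1 ha with h | ⟨i, rfl⟩ <;> rcases (hD b).1 hb with h' | ⟨j, rfl⟩
        · have h1 := hγ a h.1 h.2
          have h2 := hγ b h'.1 h'.2
          rw [hπ' a h1, hπ' b h2] at key hx
          exact key hab x hx
        · have h1 := hγ a h.1 h.2
          rw [hπ' a h1, hπ] at key hx
          exact le_of_forall_eq_iff hxν (hlow j a h1)
            (key (h.2.trans_le (hβμ j).2) x hx)
        · exact absurd (hab.trans (hγ b h'.1 h'.2)) (lt_asymm (hβ' i).1)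
        · rw [hπ, hπ] at key hx
          have h1 := (hlt i j).2 hab
          exact le_of_forall_eq_iff hxν (hhigh i j h1) (key h1 x hx) }
  have hpval : ∀ a ∈ D, p.val a = q.val (π a) := fun a ha => if_pos ha
  refine ⟨p, hDμ, fun r hr hrp => ?_⟩
  have hr' : ∀ a ∈ r.dom, a < μ := hr
  have hdom : ∀ a ∈ r.dom ∪ q.dom, (a ∈ r.dom ∧ a < μ) ∨ ∃ j, β j = a := fun a ha => by
    rcases Finset.mem_union.1 ha with h | h
    · exact Or.inl ⟨h, hr' a h⟩
    · rcases lt_or_ge a μ with h' | h'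
      · exact Or.inl ⟨hrp.1 ((hD a).2 (Or.inl ⟨h, h'⟩)), h'⟩
      · exact Or.inr ((hβ a).1 ⟨h, h'⟩)
  have hβ'r : ∀ j, β' j ∈ r.dom := fun j => hrp.1 ((hD _).2 (Or.inr ⟨j, rfl⟩))
  have hσr : ∀ a ∈ r.dom ∪ q.dom, σ a ∈ r.dom := fun a ha => by
    rcases hdom a ha with h | ⟨j, rfl⟩
    · rw [hσ' a h.2]
      exact h.1
    · rw [hσ]
      exact hβ'r j
  -- At each `β j` the value is `r (β' j)` cut off at `ν`. The extension `r` may have added elements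
  -- at or above `ν`, over which the pattern has no control; the cut preserves initial segments and
  -- loses nothing of `q`.
  let V : Ordinal.{u} → Finset Ordinal.{u} := fun a =>
    if a ∈ r.dom ∪ q.dom then (r.val (σ a)).filter (fun x => μ ≤ a → x < ν) else ∅
  have hV : ∀ a ∈ r.dom ∪ q.dom, ∀ x, x ∈ V a ↔ x ∈ r.val (σ a) ∧ (μ ≤ a → x < ν) :=
    fun a ha x => by
      simp only [V, if_pos ha, Finset.mem_filter]
  let s : Cond ρ :=
    { dom := r.dom ∪ q.dom
      val := V
      val_off := fun a ha => if_neg ha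
      dom_lt := fun a ha => (Finset.mem_union.1 ha).elim (r.dom_lt a) (q.dom_lt a)
      val_lt := fun a ha x hx => r.val_lt _ (hσr a ha) x ((hV a ha x).1 hx).1
      level := fun a ha ξ hξ x hx y hy =>
        r.level _ (hσr a ha) ξ hξ x ((hV a ha x).1 hx).1 y ((hV a ha y).1 hy).1
      initial := fun a ha b hb x hx y hy hyx => by
        obtain ⟨hxa, hxb⟩ := Finset.mem_inter.1 hx
        rw [hV a ha] at hxa hy
        rw [hV b hb] at hxb ⊢
        exact ⟨r.initial _ (hσr a ha) _ (hσr b hb) x (Finset.mem_inter.2 ⟨hxa.1, hxb.1⟩) y hy.1 hyx,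
          fun h => hyx.trans (hxb.2 h)⟩
      delta := fun a ha b hb hab x hx => by
        obtain ⟨hxa, hxb⟩ := Finset.mem_inter.1 hx
        rw [hV a ha] at hxa
        rw [hV b hb] at hxb
        have hx' := Finset.mem_inter.2 ⟨hxa.1, hxb.1⟩
        have key := r.delta _ (hσr a ha) _ (hσr b hb)
        rcases hdom a ha with h | ⟨i, rfl⟩ <;> rcases hdom b hb with h' | ⟨j, rfl⟩
        · rw [hσ' a h.2, hσ' b h'.2] at key hx'
          exact key hab x hx'
        · have hxν := hxb.2 (hβμ j).2
          rcases lt_or_ge a γ with h1 | h1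
          · rw [hσ' a h.2, hσ] at key hx'
            exact le_of_forall_eq_iff hxν (fun ξ hξ => (hlow j a h1 ξ hξ).symm)
              (key (h1.trans (hβ' j).1) x hx')
          -- This case includes the copies `β' i`, which may share many elements with `β j`: the cut
          -- at `ν` keeps all of these below `ρ a (β j)`.
          · exact hxν.le.trans (hbig j a h.2 h1)
        · exact absurd (hab.trans h'.2) (not_lt.2 (hβμ i).2)
        · have hxν := hxb.2 (hβμ j).2
          rw [hσ, hσ] at key hx'
          exact le_of_forall_eq_iff hxν (fun ξ hξ => (hhigh i j hab ξ hξ).symm)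
            (key ((hlt i j).1 hab) x hx') }
  refine ⟨s, ⟨Finset.subset_union_left, fun a ha x hx => ?_⟩,
    ⟨Finset.subset_union_right, fun a ha x hx => ?_⟩⟩
  · refine (hV a (Finset.mem_union_left _ ha) x).2 ⟨?_, fun h => absurd (hr' a ha) (not_lt.2 h)⟩
    rwa [hσ' a (hr' a ha)]
  · have ha' := Finset.mem_union_right r.dom ha
    refine (hV a ha' x).2 ⟨?_, fun _ => hν a ha x hx⟩
    rcases lt_or_ge a μ with h | h
    · have haD := (hD a).2 (Or.inl ⟨ha, h⟩)
      rw [hσ' a h]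
      refine hrp.2 a haD ?_
      rwa [hpval a haD, hπ' a (hγ a ha h)]
    · obtain ⟨j, rfl⟩ := (hβ a).1 ⟨ha, h⟩
      have haD := (hD (β' j)).2 (Or.inr ⟨j, rfl⟩)
      rw [hσ]
      refine hrp.2 _ haD ?_
      rwa [hpval _ haD, hπ]

/-- Conditions on `A` that are compatible are compatible as conditions on `A`. -/
theorem exists_le_mem_condOn (A : Set Ordinal.{u}) {p q r : Cond ρ} (hp : p ∈ condOn ρ A)
    (hq : q ∈ condOn ρ A) (hrp : r ≤ p) (hrq : r ≤ q) : ∃ s ∈ condOn ρ A, s ≤ p ∧ s ≤ q := by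
  classical
  have hsub : ∀ a ∈ r.dom.filter (· ∈ A), a ∈ r.dom := fun a ha => (Finset.mem_filter.1 ha).1
  let s : Cond ρ :=
    { dom := r.dom.filter (· ∈ A)
      val := fun a => if a ∈ A then r.val a else ∅
      val_off := fun a ha => by
        split_ifs with h
        · exact r.val_off a fun h' => ha (Finset.mem_filter.2 ⟨h', h⟩)
        · rfl
      dom_lt := fun a ha => r.dom_lt a (hsub a ha)
      val_lt := fun a ha x hx => by
        rw [if_pos (Finset.mem_filter.1 ha).2] at hx
        exact r.val_lt a (hsub a ha) x hx
      level := fun a ha => by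
        simp only [if_pos (Finset.mem_filter.1 ha).2]
        exact r.level a (hsub a ha)
      initial := fun a ha b hb => by
        simp only [if_pos (Finset.mem_filter.1 ha).2, if_pos (Finset.mem_filter.1 hb).2]
        exact r.initial a (hsub a ha) b (hsub b hb)
      delta := fun a ha b hb => by
        simp only [if_pos (Finset.mem_filter.1 ha).2, if_pos (Finset.mem_filter.1 hb).2]
        exact r.delta a (hsub a ha) b (hsub b hb) }
  have hs : ∀ p ∈ condOn ρ A, r ≤ p → s ≤ p := fun p hp hrp =>
    ⟨fun a ha => Finset.mem_filter.2 ⟨hrp.1 ha, hp a ha⟩, fun a ha x hx => by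
      change x ∈ ite _ _ _
      rw [if_pos (hp a ha)]
      exact hrp.2 a ha hx⟩
  exact ⟨s, fun a ha => (Finset.mem_filter.1 ha).2, hs p hp hrp, hs q hq hrq⟩

/-! ### Reflecting patterns of ordinals -/

/-- The sets of ordinals being counted live one universe up, so CH is lifted there before `𝔠 ^ ℵ₀ =
𝔠` is applied. -/
theorem aleph_one_pow_aleph0 (hCH : (𝔠 : Cardinal.{u}) = ℵ_ 1) :
    (ℵ_ 1 : Cardinal.{u + 1}) ^ (ℵ₀ : Cardinal.{u + 1}) = ℵ_ 1 := by
  have h : (𝔠 : Cardinal.{u + 1}) = ℵ_ 1 := by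
    have h := congrArg Cardinal.lift.{u + 1} hCH
    rwa [lift_continuum, lift_aleph, Ordinal.lift_one] at h
  rw [← h, continuum_power_aleph0]

/-- Under `CH` a family of countable subsets of a set of size `ℵ₁` has at most `ℵ₁` members, so that
it is enumerated along any set of size `ℵ₁`. -/
theorem exists_representatives (hCH : (𝔠 : Cardinal.{u}) = ℵ_ 1) {X Y : Type (u + 1)} [Nonempty X]
    (hY : #Y ≤ ℵ_ 1) (T : X → Set Y) (hT : ∀ x, (T x).Countable) {I : ZFSet.{u}}
    (hI : I.card = ℵ_ 1) : ∃ f : {x // x ∈ I} → X, ∀ x, ∃ i, T x = T (f i) := by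
  have h1 : #(Set.range T) ≤ ℵ_ 1 := by
    calc #(Set.range T) ≤ #{t : Set Y // #t ≤ ℵ₀} :=
          Cardinal.mk_subtype_mono (by
            rintro _ ⟨x, rfl⟩
            exact Cardinal.le_aleph0_iff_set_countable.2 (hT x))
      _ ≤ max #Y ℵ₀ ^ (ℵ₀ : Cardinal.{u + 1}) := Cardinal.mk_bounded_set_le _ _
      _ ≤ (ℵ_ 1) ^ (ℵ₀ : Cardinal.{u + 1}) :=
          Cardinal.power_le_power_right (max_le hY (aleph0_le_aleph 1))
      _ = ℵ_ 1 := aleph_one_pow_aleph0 hCH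
  obtain ⟨g, hg⟩ := exists_surjective_of_card_le (X := Set.range T) (I := I) (by
    rw [hI, lift_aleph, Ordinal.lift_one]
    exact h1)
  refine ⟨fun i => (g i).2.choose, fun x => ?_⟩
  obtain ⟨i, hi⟩ := hg ⟨T x, x, rfl⟩
  refine ⟨i, ?_⟩
  rw [(g i).2.choose_spec, hi]

theorem card_le_aleph_one_iff_lt_omega_two {a : Ordinal.{u}} : a.card ≤ ℵ_ 1 ↔ a < ω_ 2 := by
  rw [← Order.lt_succ_iff, succ_aleph, ← Cardinal.lt_ord, ord_aleph]
  norm_num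

/-- The pattern of a finite sequence of sets with respect to the set `R` of triples: which triples
it forms with members of `γ`, and which relations hold between its terms. -/
def pattern {k : ℕ} (R : ZFSet.{u}) (γ ν : Ordinal.{u}) (x : Fin k → ZFSet.{u}) :
    Set ((Fin k × Set.Iio γ × Set.Iio ν) ⊕ ((Fin k × Fin k) ⊕ (Fin k × Fin k × Set.Iio ν))) :=
  {z | Sum.elim
    (fun p => ZFSet.pair (ZFSet.pair p.2.1.1.toZFSet (x p.1)) p.2.2.1.toZFSet ∈ R)
    (Sum.elim (fun p => x p.1 ∈ x p.2)
      (fun p => ZFSet.pair (ZFSet.pair (x p.1) (x p.2.1)) p.2.2.1.toZFSet ∈ R)) z}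

/-- A recorded triple `(j, a, ξ)` puts `a` in the section of `ρ` at `x j` bounded by `ν`, which is
countable. The other two kinds of data have countable index sets. -/
theorem countable_pattern {k : ℕ}
    (hρ : ∀ ν < ω_ 1, ∀ β < ω_ 2, {α | α < β ∧ ρ α β ≤ ν}.Countable)
    {γ ν : Ordinal.{u}} (hν : ν < ω_ 1) (x : Fin k → ZFSet.{u}) :
    (pattern (funGraph ρ) γ ν x).Countable := by
  have hνc : Countable (Set.Iio ν) := (countable_Iio_of_lt hν).to_subtype
  have hD : ∀ j, {a : Set.Iio γ | ∃ ξ < ν, ZFSet.pair (ZFSet.pair a.1.toZFSet (x j)) ξ.toZFSet ∈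
      funGraph ρ}.Countable := by
    intro j
    by_cases hj : ∃ b < ω_ 2, b.toZFSet = x j
    · obtain ⟨b, hb, hbx⟩ := hj
      refine Set.Countable.mono ?_ ((hρ ν hν b hb).preimage Subtype.val_injective)
      rintro a ⟨ξ, hξ, h⟩
      obtain ⟨a', b', hab, -, h1, h2, h3⟩ := triple_mem_funGraph_iff.1 h
      have h1 := toZFSet_injective h1
      have h2 := toZFSet_injective (h2.trans hbx.symm)
      have h3 := toZFSet_injective h3
      subst h1 h2 h3
      exact ⟨hab, hξ.le⟩
    · convert! Set.countable_empty
      refine Set.eq_empty_of_forall_notMem ?_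
      rintro a ⟨ξ, hξ, h⟩
      obtain ⟨a', b', -, hb', h1, h2, h3⟩ := triple_mem_funGraph_iff.1 h
      exact hj ⟨b', hb', h2⟩
  have h1 : (⋃ j : Fin k, (fun p : Set.Iio γ × Set.Iio ν => (j, p)) ''
      ({a : Set.Iio γ | ∃ ξ < ν, ZFSet.pair (ZFSet.pair a.1.toZFSet (x j)) ξ.toZFSet ∈
        funGraph ρ} ×ˢ Set.univ)).Countable :=
    Set.countable_iUnion fun j => ((hD j).prod Set.countable_univ).image _
  refine Set.Countable.mono ?_ ((h1.image Sum.inl).union (Set.countable_range Sum.inr))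
  rintro (⟨j, a, ξ⟩ | z) h
  · exact Or.inl ⟨_, Set.mem_iUnion.2 ⟨j, (a, ξ), ⟨⟨ξ.1, ξ.2, h⟩, trivial⟩, rfl⟩, rfl⟩
  · exact Or.inr ⟨z, rfl⟩

/-- The pattern of a finite sequence of ordinals occurs in every elementary submodel that contains
the parameters and a suitable countable ordinal. -/
theorem exists_same_pattern (hCH : (𝔠 : Cardinal.{u}) = ℵ_ 1) (hθ : θ.IsRegular) (hθ' : ℵ_ 2 < θ)
    (hρ : ∀ ν < ω_ 1, ∀ β < ω_ 2, {α | α < β ∧ ρ α β ≤ ν}.Countable)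
    (hR : InModel S (funGraph ρ)) {γ ν : Ordinal.{u}} (hγ : γ < ω_ 2) (hν : ν < ω_ 1)
    (hγS : InModel S γ.toZFSet) (hνS : InModel S ν.toZFSet) {k : ℕ} (β : Fin k → Ordinal.{u})
    (hβ : ∀ j, γ < β j ∧ β j < ω_ 2) :
    ∃ i < ω_ 1, ∀ T : setLang.ElementarySubstructure (hered θ), (∀ z ∈ S, z ∈ T) →
      InModel T i.toZFSet → ∃ β' : Fin k → Ordinal.{u},
        (∀ j, InModel T (β' j).toZFSet ∧ γ < β' j ∧ β' j < ω_ 2) ∧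
        (∀ j, ∀ a < γ, ∀ ξ < ν, ρ a (β j) = ξ ↔ ρ a (β' j) = ξ) ∧
        (∀ i j, β i < β j ↔ β' i < β' j) ∧
        ∀ i j, β i < β j → ∀ ξ < ν, ρ (β i) (β j) = ξ ↔ ρ (β' i) (β' j) = ξ := by
  have h1S := inModel_omega_one hθ hθ' hR
  obtain ⟨R, hRS, hRe⟩ := hR
  obtain ⟨c, hcS, hce⟩ := hγS
  obtain ⟨d, hdS, hde⟩ := hνS
  obtain ⟨I, hIS, hIe⟩ := h1S
  -- good sequences are sequences of ordinals in the interval from `γ` to `ω₂`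
  let G : (Fin k → hered θ) → Prop := fun x => ∀ j, InDom R (x j) ∧ c.1 ∈ (x j).1
  -- `E` says, with parameters in `S`, that a good `x` and `y` have the same pattern and that `y` is
  -- good too. Tuples that are not good are related to everything, so representatives of good tuples
  -- suffice.
  let E : (Fin k → hered θ) → (Fin k → hered θ) → Prop := fun x y => G x → G y ∧
    (∀ j, ∀ a ξ : hered θ, a.1 ∈ c.1 → ξ.1 ∈ d.1 →
      (ZFSet.pair (ZFSet.pair a.1 (x j).1) ξ.1 ∈ R.1 ↔
        ZFSet.pair (ZFSet.pair a.1 (y j).1) ξ.1 ∈ R.1)) ∧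
    (∀ i j, (x i).1 ∈ (x j).1 ↔ (y i).1 ∈ (y j).1) ∧
    (∀ i j, ∀ ξ : hered θ, ξ.1 ∈ d.1 →
      (ZFSet.pair (ZFSet.pair (x i).1 (x j).1) ξ.1 ∈ R.1 ↔
        ZFSet.pair (ZFSet.pair (y i).1 (y j).1) ξ.1 ∈ R.1))
  have hG : ∀ {α : Type} (σ : Fin k → α), Df S (fun w : α → hered θ => G fun j => w (σ j)) :=
    fun σ => .finAll fun j => (Df.inDom hθ (.const hRS) (.var _)).and (.mem (.const hcS) (.var _))
  have hE : Df S (fun w : Fin k ⊕ Fin k → hered θ => E (fun b => w (.inl b))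
      (fun b => w (.inr b))) := by
    refine (hG _).imp ((hG _).and (.and ?_ (.and ?_ ?_)))
    · refine .finAll fun j => .all (.all ((Df.mem (.var _) (.const hcS)).imp
        ((Df.mem (.var _) (.const hdS)).imp (.iff ?_ ?_)))) <;>
      exact .triple_mem hθ (.var _) (.var _) (.var _) (.const hRS)
    · exact .finAll fun i => .finAll fun j => .iff (.mem (.var _) (.var _)) (.mem (.var _) (.var _))
    · refine .finAll fun i => .finAll fun j => .all ((Df.mem (.var _) (.const hdS)).imp
        (.iff ?_ ?_)) <;>
      exact .triple_mem hθ (.var _) (.var _) (.var _) (.const hRS)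
  have hβH : ∀ j, (β j).toZFSet ∈ hered θ := fun j => toZFSet_mem_hered (by
    refine (card_le_aleph_one_iff_lt_omega_two.2 (hβ j).2).trans_lt (lt_trans ?_ hθ')
    exact aleph_lt_aleph.2 (by norm_num))
  let b : Fin k → hered θ := fun j => ⟨_, hβH j⟩
  have hb : G b := fun j => ⟨(inDom_iff hRe).2 ⟨β j, (hβ j).2, rfl⟩, by
    rw [hce]
    exact toZFSet_mem_toZFSet_iff.2 (hβ j).1⟩
  have : Nonempty {x // G x} := ⟨⟨b, hb⟩⟩
  -- Since `γ < ω₂` and `ν < ω₁`, the set in which patterns live has size at most `ℵ₁`.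
  obtain ⟨f, hf⟩ := exists_representatives hCH (X := {x // G x}) (I := I.1) (by
      have hγc : #(Set.Iio γ) ≤ ℵ_ 1 := by
        rw [Cardinal.mk_Iio_ordinal, ← Ordinal.lift_one.{u, u + 1}, ← lift_aleph, Cardinal.lift_le]
        exact card_le_aleph_one_iff_lt_omega_two.2 hγ
      have hνc : #(Set.Iio ν) ≤ ℵ_ 1 :=
        (Cardinal.le_aleph0_iff_set_countable.2 (countable_Iio_of_lt hν)).trans
          (aleph0_le_aleph 1)
      have h1 : (ℵ₀ : Cardinal.{u + 1}) ≤ ℵ_ 1 := aleph0_le_aleph 1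
      have hk : ∀ n : ℕ, (n : Cardinal.{u + 1}) ≤ ℵ_ 1 := fun n => natCast_le_aleph0.trans h1
      have hmul : ∀ {a b : Cardinal.{u + 1}}, a ≤ ℵ_ 1 → b ≤ ℵ_ 1 → a * b ≤ ℵ_ 1 :=
        fun ha hb => mul_le_of_le h1 ha hb
      have hadd : ∀ {a b : Cardinal.{u + 1}}, a ≤ ℵ_ 1 → b ≤ ℵ_ 1 → a + b ≤ ℵ_ 1 :=
        fun ha hb => add_le_of_le h1 ha hb
      simp only [mk_sum, mk_prod, Cardinal.lift_id, mk_fin, Cardinal.lift_natCast, Cardinal.lift_mul,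
        Cardinal.lift_uzero]
      exact hadd (hmul (hk _) (hmul hγc hνc)) (hadd (hmul (hk _) (hk _))
        (hmul (hk _) (hmul (hk _) hνc))))
    (fun x => pattern (funGraph ρ) γ ν fun j => (x.1 j).1)
    (fun x => countable_pattern hρ hν _) (by rw [hIe, card_toZFSet, card_omega])
  obtain ⟨i, hi, h⟩ := exists_related_mem hθ hIS hE (fun i => (f i).1) (fun x => by
    by_cases hx : G x
    · obtain ⟨i, hi⟩ := hf ⟨x, hx⟩
      refine ⟨i, fun _ => ⟨(f i).2, fun j a ξ ha hξ => ?_, fun i' j => ?_, fun i' j ξ hξ => ?_⟩⟩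
      · rw [hce, mem_toZFSet_iff] at ha
        rw [hde, mem_toZFSet_iff] at hξ
        obtain ⟨a', ha', h⟩ := ha
        obtain ⟨ξ', hξ', h'⟩ := hξ
        rw [← h, ← h', hRe]
        exact Set.ext_iff.1 hi (Sum.inl (j, ⟨a', ha'⟩, ⟨ξ', hξ'⟩))
      · exact Set.ext_iff.1 hi (Sum.inr (Sum.inl (i', j)))
      · rw [hde, mem_toZFSet_iff] at hξ
        obtain ⟨ξ', hξ', h'⟩ := hξ
        rw [← h', hRe]
        exact Set.ext_iff.1 hi (Sum.inr (Sum.inr (i', j, ⟨ξ', hξ'⟩)))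
    · obtain ⟨i, -⟩ := hf ⟨b, hb⟩
      exact ⟨i, fun h => absurd h hx⟩) b
  obtain ⟨i', hi', hii⟩ := mem_toZFSet_iff.1 (hIe ▸ hi)
  refine ⟨i', hi', fun T hST hiT => ?_⟩
  obtain ⟨y, hyT, hy⟩ := h T hST (InModel.mem (hii ▸ hiT))
  obtain ⟨hyG, hy1, hy2, hy3⟩ := hy hb
  choose β' hβ' hβ'y using fun j => (inDom_iff hRe).1 (hyG j).1
  have hlt : ∀ i j, β i < β j ↔ β' i < β' j := fun i j => by
    have := hy2 i j
    rw [← hβ'y, ← hβ'y, toZFSet_mem_toZFSet_iff] at this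
    exact this.trans toZFSet_mem_toZFSet_iff
  have htr : ∀ {a b' ξ : Ordinal.{u}}, a < b' → b' < ω_ 2 →
      (ZFSet.pair (ZFSet.pair a.toZFSet b'.toZFSet) ξ.toZFSet ∈ R.1 ↔ ρ a b' = ξ) := by
    intro a b' ξ hab hb'
    rw [hRe, triple_mem_funGraph_iff]
    constructor
    · rintro ⟨a', b'', -, -, h1, h2, h3⟩
      rw [← toZFSet_injective h1, ← toZFSet_injective h2]
      exact toZFSet_injective h3
    · intro h
      exact ⟨a, b', hab, hb', rfl, rfl, congrArg _ h⟩
  have hγβ' : ∀ j, γ < β' j := fun j => by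
    have := (hyG j).2
    rwa [hce, ← hβ'y, toZFSet_mem_toZFSet_iff] at this
  have hdH : ∀ ξ < ν, ξ.toZFSet ∈ hered θ := fun ξ hξ =>
    mem_hered_of_mem d.2 (by rw [hde]; exact toZFSet_mem_toZFSet_iff.2 hξ)
  refine ⟨β', fun j => ⟨⟨y j, hyT j, (hβ'y j).symm⟩, hγβ' j, hβ' j⟩, fun j a ha ξ hξ => ?_, hlt,
    fun i j hij ξ hξ => ?_⟩
  · have haH : a.toZFSet ∈ c.1 := by rw [hce]; exact toZFSet_mem_toZFSet_iff.2 ha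
    have h := hy1 j ⟨_, mem_hered_of_mem c.2 haH⟩ ⟨_, hdH ξ hξ⟩ haH
      (by rw [hde]; exact toZFSet_mem_toZFSet_iff.2 hξ)
    rw [← hβ'y] at h
    exact (htr (ha.trans (hβ j).1) (hβ j).2).symm.trans
      (h.trans (htr (ha.trans (hγβ' j)) (hβ' j)))
  · have h := hy3 i j ⟨_, hdH ξ hξ⟩ (by rw [hde]; exact toZFSet_mem_toZFSet_iff.2 hξ)
    rw [← hβ'y, ← hβ'y] at h
    exact (htr hij (hβ j).2).symm.trans (h.trans (htr ((hlt i j).1 hij) (hβ' j)))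

/-! ### Chains of elementary submodels -/

theorem IsElemChain.exists_model (hN : IsElemChain θ N) {ξ : Ordinal.{u}} (hξ : ξ < ω_ 1) :
    ∃ S : setLang.ElementarySubstructure (hered θ), ∀ x, x ∈ N ξ ↔ InModel S x :=
  hN.elem ξ hξ

theorem add_one_lt_omega {o ξ : Ordinal.{u}} (hξ : ξ < ω_ o) : ξ + 1 < ω_ o :=
  (Cardinal.isSuccLimit_omega o).succ_lt hξ

theorem IsElemChain.subset_add_one (hN : IsElemChain θ N) (hθ : θ.IsRegular) (hθ' : ℵ₀ < θ)
    {ξ : Ordinal.{u}} (hξ : ξ < ω_ 1) {x : ZFSet.{u}} (hx : x ∈ N ξ) : x ∈ N (ξ + 1) := by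
  obtain ⟨S, hS⟩ := hN.exists_model (add_one_lt_omega hξ)
  rw [hS]
  exact ((hS _).1 (hN.mem_succ ξ hξ)).subset_of_countable hθ hθ' (hN.countable ξ hξ) hx

theorem IsElemChain.mono (hN : IsElemChain θ N) (hθ : θ.IsRegular) (hθ' : ℵ₀ < θ)
    {ξ η : Ordinal.{u}} (h : ξ ≤ η) (hη : η < ω_ 1) {x : ZFSet.{u}} (hx : x ∈ N ξ) : x ∈ N η := by
  induction η using Ordinal.limitRecOn with
  | zero => rwa [nonpos_iff_eq_zero.1 h] at hx
  | add_one η ih =>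
    rcases h.eq_or_lt with rfl | h
    · exact hx
    · have hη' := (lt_add_one η).trans hη
      exact hN.subset_add_one hθ hθ' hη' (ih (Order.lt_add_one_iff.1 h) hη')
  | limit η hl ih =>
    rcases h.eq_or_lt with rfl | h
    · exact hx
    · exact (hN.continuous η hη hl x).2 ⟨ξ, h, hx⟩

theorem IsElemChain.exists_common (hN : IsElemChain θ N) (hθ : θ.IsRegular) (hθ' : ℵ₀ < θ)
    {ι : Type*} [Countable ι] {x : ι → ZFSet.{u}} (h : ∀ i, ∃ ξ < ω_ 1, x i ∈ N ξ) :
    ∃ ξ < ω_ 1, ∀ i, x i ∈ N ξ := by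
  choose ξ hξ hx using h
  have hsup : ⨆ i, ξ i < ω_ 1 := Ordinal.iSup_lt_omega_one hξ
  have hbdd : BddAbove (Set.range ξ) := ⟨ω_ 1, by
    rintro _ ⟨i, rfl⟩
    exact (hξ i).le⟩
  exact ⟨⨆ i, ξ i, hsup, fun i => hN.mono hθ hθ' (le_ciSup hbdd i) hsup (hx i)⟩

theorem mem_hered_omega_two (hθ' : ℵ_ 2 < θ) {a : Ordinal.{u}} (ha : a < ω_ 2) :
    a.toZFSet ∈ hered θ :=
  toZFSet_mem_hered ((card_le_aleph_one_iff_lt_omega_two.2 ha).trans_lt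
    ((aleph_lt_aleph.2 (by norm_num)).trans hθ'))

theorem omega_one_lt_omega_two : (ω_ 1 : Ordinal.{u}) < ω_ 2 := omega_lt_omega.2 (by norm_num)

/-- Induction on `a`. Once all smaller ordinals lie in `N ξ`, either `a` does too or it is the least
ordinal missing from `N ξ`, hence definable in `N (ξ + 1)` from `N ξ` and the graph of `ρ`. -/
theorem IsElemChain.exists_mem_of_lt_omega_one (hN : IsElemChain θ N) (hθ : θ.IsRegular)
    (hθ' : ℵ_ 2 < θ)
    (hρ : ∃ ξ < ω_ 1, funGraph ρ ∈ N ξ) (a : Ordinal.{u}) (ha : a < ω_ 1) :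
    ∃ ξ < ω_ 1, a.toZFSet ∈ N ξ := by
  have h0 : ℵ₀ < θ := (aleph0_le_aleph 2).trans_lt hθ'
  induction a using WellFoundedLT.induction with
  | ind a ih =>
    have : Countable (Set.Iio a) := (countable_Iio_of_lt ha).to_subtype
    obtain ⟨ξ, hξ, h⟩ := hN.exists_common hθ h0
      (x := fun o : Option (Set.Iio a) => o.elim (funGraph ρ) fun b => b.1.toZFSet) (by
        rintro (_ | b)
        · exact hρ
        · exact ih b.1 b.2 (lt_trans b.2 ha))
    by_cases haξ : a.toZFSet ∈ N ξ
    · exact ⟨ξ, hξ, haξ⟩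
    refine ⟨ξ + 1, add_one_lt_omega hξ, ?_⟩
    obtain ⟨S, hS⟩ := hN.exists_model (add_one_lt_omega hξ)
    obtain ⟨R, hRS, hRe⟩ := (hS _).1 (hN.subset_add_one hθ h0 hξ (h none))
    obtain ⟨A, hAS, hAe⟩ := (hS _).1 (hN.mem_succ ξ hξ)
    rw [hS]
    refine .of_definable (P := fun x => InDom R x ∧ ¬ x.1 ∈ A.1 ∧
      ∀ y : hered θ, y.1 ∈ x.1 → y.1 ∈ A.1) (mem_hered_omega_two hθ'
        (ha.trans omega_one_lt_omega_two)) ?_ ⟨?_, ?_, ?_⟩ ?_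
    · exact (Df.inDom hθ (.const hRS) (.var _)).and ((Df.not (.mem (.var _) (.const hAS))).and
        (.all ((Df.mem (.var _) (.var _)).imp (.mem (.var _) (.const hAS)))))
    · exact (inDom_iff hRe).2 ⟨a, ha.trans omega_one_lt_omega_two, rfl⟩
    · rwa [hAe]
    · intro y hy
      obtain ⟨b, hb, hby⟩ := mem_toZFSet_iff.1 hy
      rw [hAe, ← hby]
      exact h (some ⟨b, hb⟩)
    · rintro y ⟨h1, h2, h3⟩
      obtain ⟨b, hb, hby⟩ := (inDom_iff hRe).1 h1
      rw [← hby, hAe] at h2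
      rw [← hby]
      rcases lt_trichotomy b a with hlt | heq | hlt
      · exact absurd (h (some ⟨b, hlt⟩)) h2
      · rw [heq]
      · refine absurd ?_ haξ
        rw [← hAe]
        exact h3 ⟨_, mem_hered_omega_two hθ' (ha.trans omega_one_lt_omega_two)⟩
          (by rw [← hby]; exact toZFSet_mem_toZFSet_iff.2 hlt)

/-! ### The supremum of the chain and its uncountable cofinality -/

theorem lt_chainSup_iff {a : Ordinal.{u}} : a < chainSup N ↔
    ∃ b, (b < ω_ 2 ∧ ∃ ξ < ω_ 1, b.toZFSet ∈ N ξ) ∧ a < b := by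
  rw [chainSup, lt_csSup_iff']
  · rfl
  · exact ⟨ω_ 2, fun _ h => h.1.le⟩

theorem IsElemChain.lt_chainSup (hN : IsElemChain θ N) (hθ : θ.IsRegular) {a ξ : Ordinal.{u}}
    (ha : a < ω_ 2) (hξ : ξ < ω_ 1) (h : a.toZFSet ∈ N ξ) : a < chainSup N := by
  obtain ⟨S, hS⟩ := hN.exists_model hξ
  exact lt_chainSup_iff.2 ⟨a + 1, ⟨add_one_lt_omega ha, ξ, hξ, (hS _).2
    (((hS _).1 h).add_one hθ)⟩, lt_add_one a⟩

theorem isRegular_aleph_two : (ℵ_ 2 : Cardinal.{u}).IsRegular := by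
  have h := isRegular_succ (aleph0_le_aleph (1 : Ordinal.{u}))
  rw [succ_aleph] at h
  norm_num at h
  exact h

theorem iSup_lt_omega_two {ι : Type*} [Countable ι] {f : ι → Ordinal.{u}}
    (hf : ∀ i, f i < ω_ 2) : ⨆ i, f i < ω_ 2 := by
  refine lift_iSup_lt_of_lt_cof ?_ hf
  rw [lift_omega, Ordinal.lift_ofNat, isRegular_aleph_two.cof_omega_eq]
  refine (Cardinal.lift_le_aleph0.2 (mk_le_aleph0_iff.2 inferInstance)).trans_lt ?_
  rw [← aleph_zero]
  exact aleph_lt_aleph.2 (by norm_num)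

/-- Bounds from the chain for the members of `A` all appear in a single `N ξ`. Since `N ξ` is a
countable element of `N (ξ + 1)`, the latter contains an ordinal below `ω₂` above all of `N ξ ∩ ω₂`.
-/
theorem IsElemChain.exists_gt_of_countable (hN : IsElemChain θ N) (hθ : θ.IsRegular)
    (hθ' : ℵ_ 2 < θ)
    (hρ : ∃ ξ < ω_ 1, funGraph ρ ∈ N ξ) {A : Set Ordinal.{u}} (hA : A.Countable)
    (hAμ : ∀ a ∈ A, a < chainSup N) :
    ∃ γ < ω_ 2, (∃ ξ < ω_ 1, γ.toZFSet ∈ N ξ) ∧ ∀ a ∈ A, a < γ := by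
  have h0 : ℵ₀ < θ := (aleph0_le_aleph 2).trans_lt hθ'
  have : Countable A := hA.to_subtype
  choose b hb hab using fun a : A => lt_chainSup_iff.1 (hAμ a.1 a.2)
  obtain ⟨ξ, hξ, h⟩ := hN.exists_common hθ h0
    (x := fun o : Option A => o.elim (funGraph ρ) fun a => (b a).toZFSet) (by
      rintro (_ | a)
      · exact hρ
      · exact (hb a).2)
  obtain ⟨S, hS⟩ := hN.exists_model (add_one_lt_omega hξ)
  obtain ⟨R, hRS, hRe⟩ := (hS _).1 (hN.subset_add_one hθ h0 hξ (h none))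
  obtain ⟨B, hBS, hBe⟩ := (hS _).1 (hN.mem_succ ξ hξ)
  obtain ⟨y, hyS, hyR, hy⟩ := Df.exists_mem (S := S) (P := fun x => InDom R x ∧
      ∀ y : hered θ, y.1 ∈ B.1 → InDom R y → y.1 ∈ x.1)
    ((Df.inDom hθ (.const hRS) (.var _)).and (.all ((Df.mem (.var _) (.const hBS)).imp
      ((Df.inDom hθ (.const hRS) (.var _)).imp (.mem (.var _) (.var _)))))) (by
      let J := {c : Ordinal.{u} // c < ω_ 2 ∧ c.toZFSet ∈ N ξ}
      have hJ : Countable J := by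
        have h1 : Countable {x // x ∈ N ξ} := by
          rw [← mk_le_aleph0_iff]
          have h2 : #{x // x ∈ N ξ} = Cardinal.lift.{u + 1} (N ξ).card := ZFSet.cardinalMk_coe_sort
          rw [h2, Cardinal.lift_le_aleph0]
          exact hN.countable ξ hξ
        refine Function.Injective.countable
          (f := fun c : J => (⟨c.1.toZFSet, c.2.2⟩ : {x // x ∈ N ξ})) fun c d hcd => ?_
        exact Subtype.ext (toZFSet_injective (Subtype.mk.inj hcd))
      have hsup : ⨆ c : J, c.1 + 1 < ω_ 2 :=
        iSup_lt_omega_two fun c => add_one_lt_omega c.2.1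
      have hbdd : BddAbove (Set.range fun c : J => c.1 + 1) := ⟨ω_ 2, by
        rintro _ ⟨c, rfl⟩
        exact (add_one_lt_omega c.2.1).le⟩
      refine ⟨⟨_, mem_hered_omega_two hθ' hsup⟩, (inDom_iff hRe).2 ⟨_, hsup, rfl⟩,
        fun y hy hyR => ?_⟩
      obtain ⟨c, hc, hcy⟩ := (inDom_iff hRe).1 hyR
      rw [← hcy, hBe] at hy
      rw [← hcy]
      exact toZFSet_mem_toZFSet_iff.2 ((lt_add_one c).trans_le
        (le_ciSup hbdd (⟨c, hc, hy⟩ : J))))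
  obtain ⟨γ, hγ, hγy⟩ := (inDom_iff hRe).1 hyR
  refine ⟨γ, hγ, ⟨ξ + 1, add_one_lt_omega hξ, (hS _).2 ⟨y, hyS, hγy.symm⟩⟩, fun a ha => ?_⟩
  refine (hab ⟨a, ha⟩).trans ?_
  have h1 := hy ⟨_, mem_hered_omega_two hθ' (hb ⟨a, ha⟩).1⟩ (by
    rw [hBe]
    exact h (some ⟨a, ha⟩)) ((inDom_iff hRe).2 ⟨_, (hb ⟨a, ha⟩).1, rfl⟩)
  rwa [← hγy, toZFSet_mem_toZFSet_iff] at h1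

theorem IsElemChain.exists_reduction (hN : IsElemChain θ N) (hCH : (𝔠 : Cardinal.{u}) = ℵ_ 1)
    (hθ : θ.IsRegular) (hθ' : ℵ_ 2 < θ)
    (hρ : ∃ ξ < ω_ 1, funGraph ρ ∈ N ξ)
    (hρc : ∀ ν < ω_ 1, ∀ β < ω_ 2, {α | α < β ∧ ρ α β ≤ ν}.Countable) (q : Cond ρ) :
    ∃ p ∈ condOn ρ (Set.Iio (chainSup N)), ∀ r ∈ condOn ρ (Set.Iio (chainSup N)), r ≤ p →
      ∃ s, s ≤ r ∧ s ≤ q := by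
  classical
  have h0 : ℵ₀ < θ := (aleph0_le_aleph 2).trans_lt hθ'
  set μ := chainSup N
  obtain ⟨ν, hν1, hν⟩ : ∃ ν < ω_ 1, ∀ b ∈ q.dom, ∀ x ∈ q.val b, x < ν := by
    refine ⟨(q.dom.biUnion q.val).sup id + 1, add_one_lt_omega ?_, fun b hb x hx => ?_⟩
    · rw [Finset.sup_lt_iff (Ordinal.omega_pos 1)]
      intro x hx
      obtain ⟨b, hb, hx⟩ := Finset.mem_biUnion.1 hx
      exact q.val_lt b hb x hx
    · exact Order.lt_add_one_iff.2 (Finset.le_sup (f := id) (Finset.mem_biUnion.2 ⟨b, hb, hx⟩))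
  let B := q.dom.filter (μ ≤ ·)
  let β : Fin B.card → Ordinal.{u} := fun j => (B.equivFin.symm j).1
  have hβB : ∀ j, β j ∈ q.dom ∧ μ ≤ β j := fun j => Finset.mem_filter.1 (B.equivFin.symm j).2
  have hβ2 : ∀ j, β j < ω_ 2 := fun j => q.dom_lt _ (hβB j).1
  -- These are the points that `γ` must exceed: the part of `dom q` below `μ`, and the `a` for which
  -- `ρ a (β j)` might fail to bound the elements below `ν`.
  have hA : {a | a < μ ∧ (a ∈ q.dom ∨ ∃ j, a < β j ∧ ρ a (β j) ≤ ν)}.Countable := by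
    refine Set.Countable.mono ?_ (q.dom.countable_toSet.union
      (Set.countable_iUnion fun j => hρc ν hν1 (β j) (hβ2 j)))
    rintro a ⟨-, h | ⟨j, h⟩⟩
    · exact Or.inl h
    · exact Or.inr (Set.mem_iUnion.2 ⟨j, h⟩)
  obtain ⟨γ, hγ2, ⟨ξ₁, hξ₁, hγN⟩, hγ⟩ := hN.exists_gt_of_countable hθ hθ' hρ hA fun a ha => ha.1
  have hγμ : γ < μ := hN.lt_chainSup hθ hγ2 hξ₁ hγN
  obtain ⟨ξ, hξ, h⟩ := hN.exists_common hθ h0 (x := ![funGraph ρ, γ.toZFSet, ν.toZFSet]) (by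
    intro i
    fin_cases i
    · exact hρ
    · exact ⟨ξ₁, hξ₁, hγN⟩
    · exact hN.exists_mem_of_lt_omega_one hθ hθ' hρ ν hν1)
  obtain ⟨S, hS⟩ := hN.exists_model hξ
  obtain ⟨i, hi, hT⟩ := exists_same_pattern hCH hθ hθ' hρc ((hS _).1 (h 0)) hγ2 hν1
    ((hS _).1 (h 1)) ((hS _).1 (h 2)) β fun j => ⟨hγμ.trans_le (hβB j).2, hβ2 j⟩
  -- The index of the pattern is a countable ordinal, so it enters the chain at some stage; the
  -- model `T` is taken late enough to contain it and to include `S`.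
  obtain ⟨η, hη, hiη⟩ := hN.exists_mem_of_lt_omega_one hθ hθ' hρ i hi
  have hζ : max ξ η < ω_ 1 := max_lt hξ hη
  obtain ⟨T, hTN⟩ := hN.exists_model hζ
  obtain ⟨β', hβ', hlow, hlt, hhigh⟩ := hT T
    (fun z hz => InModel.mem ((hTN _).1 (hN.mono hθ h0 (le_max_left _ _) hζ
      ((hS _).2 ⟨z, hz, rfl⟩))))
    ((hTN _).1 (hN.mono hθ h0 (le_max_right _ _) hζ hiη))
  refine exists_reduction_of_copy (μ := μ) (γ := γ) (ν := ν) q β β'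
    (fun i j hij => B.equivFin.symm.injective (Subtype.ext hij)) (fun b => ⟨fun hb => ?_, ?_⟩)
    (fun j => ⟨(hβ' j).2.1, hN.lt_chainSup hθ (hβ' j).2.2 hζ ((hTN _).2 (hβ' j).1)⟩)
    (fun a ha haμ => hγ a ⟨haμ, Or.inl ha⟩) hν (fun j a ha hγa => ?_) hlow hlt hhigh
  · refine ⟨B.equivFin ⟨b, Finset.mem_filter.2 hb⟩, ?_⟩
    simp [β]
  · rintro ⟨j, rfl⟩
    exact hβB j
  · by_contra hlt'
    exact absurd (hγ a ⟨ha, Or.inr ⟨j, ha.trans_le (hβB j).2, (not_le.1 hlt').le⟩⟩)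
      (not_lt.2 hγa)

end Komjath

theorem mainTheorem8
    (C : Ordinal.{u} → Set Ordinal.{u}) (hC : Komjath.IsSquareSeq C)
    (hCH : (𝔠 : Cardinal.{u}) = ℵ_ 1)
    (θ : Cardinal.{u}) (hθ : θ.IsRegular) (hθ' : ℵ_ 2 < θ)
    (N : Ordinal.{u} → ZFSet.{u}) (hN : Komjath.IsElemChain θ N)
    (hρ : ∃ ξ < ω_ 1, Komjath.funGraph (Komjath.rho C) ∈ N ξ) :
    Komjath.IsCompleteSuborder
      (Komjath.condOn (Komjath.rho C) (Set.Iio (Komjath.chainSup N))) where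
  compatible _ hp _ hq := fun ⟨_, hrp, hrq⟩ => Komjath.exists_le_mem_condOn _ hp hq hrp hrq
  reduction q := hN.exists_reduction hCH hθ hθ' hρ
    (fun _ hν β hβ => Komjath.countable_rho_le hC hν β hβ) q
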